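/- Let $I=[0,\pi]$ and let $H^0$ be the Hilbert space of vector functions $F=(f_1,f_2)$ with $f_1,f_2\in L^2(I)$ (complex valued) and scalar product $\langle F,G\rangle=\frac1\pi\int_0^\pi\bigl(f_1\overline{g_1}+f_2\overline{g_2}\bigr)\,dx$. Let $P,Q\in L^2(I)$ and $$Ly=i\begin{pmatrix}1&0\\0&-1\end{pmatrix}\frac{dy}{dx}+v(x)\,y,\qquad v=\begin{pmatrix}0&P\\Q&0\end{pmatrix},\qquad y=\begin{pmatrix}y_1\\y_2\end{pmatrix},$$ considered as an unbounded operator in $H^0$ with domain the set of all $y\in (W_1^2(I))^2$ (both components absolutely continuous with derivative in $L^2(I)$) that satisfy one of the following boundary conditions $bc$: periodic, $y(0)=y(\pi)$; antiperiodic, $y(0)=-y(\pi)$; or Dirichlet, $y_1(0)=y_2(0)$ and $y_1(\pi)=y_2(\pi)$. Let $L^0$ be the free operator, that is, the operator with $v=0$ and the same boundary condition. Then there is $N\in\mathbb N$ (depending on $v$ and $bc$) such that for all $n\in\mathbb Z$ with $|n|>N$ the Riesz projections $$P_n=\frac1{2\pi i}\int_{|\lambda-n|=1/2}(\lambda-L)^{-1}\,d\lambda,\qquad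 P_n^0=\frac1{2\pi i}\int_{|\lambda-n|=1/2}(\lambda-L^0)^{-1}\,d\lambda$$ are well defined (the circle $|\lambda-n|=1/2$ lies in the resolvent sets of $L$ and of $L^0$, and the resolvents are integrable along it in operator norm), and $$\sum_{|n|>N}\|P_n-P_n^0\|^2<\infty,$$ where $\|\cdot\|$ is the operator norm on $H^0$. -/

import Mathlib

open MeasureTheory Set
open scoped Real

namespace DiracOp

/-! ### Resolvents and Riesz projections of unbounded operators -/

section Resolvent

variable {E : Type*} [NormedAddCommGroup E] [NormedSpace ℂ E]

/-- The bounded operator `R` is a two-sided inverse of `z - A : D(A) → E`. -/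
def IsResolventAt (A : E →ₗ.[ℂ] E) (z : ℂ) (R : E →L[ℂ] E) : Prop :=
  (∀ f : E, ∃ y : A.domain, (y : E) = R f ∧ z • (y : E) - A y = f) ∧
    ∀ y : A.domain, R (z • (y : E) - A y) = y

/-- The resolvent set of an unbounded operator: all `z` for which `z - A : D(A) → E` has a
bounded everywhere defined inverse. -/
def unbddResolventSet (A : E →ₗ.[ℂ] E) : Set ℂ :=
  {z | ∃ R : E →L[ℂ] E, IsResolventAt A z R}

open Classical in
/-- The resolvent `(z - A)⁻¹` (and `0` if `z` is not in the resolvent set). -/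
noncomputable def unbddResolvent (A : E →ₗ.[ℂ] E) (z : ℂ) : E →L[ℂ] E :=
  if h : z ∈ unbddResolventSet A then h.choose else 0

theorem isResolventAt_unbddResolvent {A : E →ₗ.[ℂ] E} {z : ℂ} (h : z ∈ unbddResolventSet A) :
    IsResolventAt A z (unbddResolvent A z) := by
  unfold unbddResolvent
  rw [dif_pos h]
  exact h.choose_spec

/-- Bounded inverses are unique, so `unbddResolvent A z` does not depend on a choice. -/
theorem IsResolventAt.unique {A : E →ₗ.[ℂ] E} {z : ℂ} {R R' : E →L[ℂ] E}
    (h : IsResolventAt A z R) (h' : IsResolventAt A z R') : R = R' := by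
  ext f
  obtain ⟨y, hy, hf⟩ := h.1 f
  rw [← hy, ← h'.2 y, hf]

/-- The integral defining the Riesz projection over the circle `|z - c| = r` makes sense: the
circle lies in the resolvent set, and the resolvent is integrable along it in operator norm. -/
def RieszWellDefined (A : E →ₗ.[ℂ] E) (c : ℂ) (r : ℝ) : Prop :=
  Metric.sphere c r ⊆ unbddResolventSet A ∧ CircleIntegrable (unbddResolvent A) c r

/-- The Riesz projection `(2πi)⁻¹ ∮_{|z - c| = r} (z - A)⁻¹ dz`. -/
noncomputable def rieszProj (A : E →ₗ.[ℂ] E) (c : ℂ) (r : ℝ) : E →L[ℂ] E :=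
  (2 * (π : ℂ) * Complex.I)⁻¹ • ∮ z in C(c, r), unbddResolvent A z

end Resolvent

/-! ### The spaces -/

/-- The normalized Lebesgue measure `dx / π` on `[0, π]`. -/
noncomputable def μI : Measure ℝ :=
  ENNReal.ofReal π⁻¹ • (volume.restrict (Icc 0 π))

/-- `L²([0, π])`, complex valued. -/
abbrev L2I : Type := Lp ℂ 2 μI

/-- The Hilbert space of `L²` vector functions `(f₁, f₂)` on `[0, π]`, with
`⟨F, G⟩ = π⁻¹ ∫ (f₁ conj g₁ + f₂ conj g₂) dx`. -/
abbrev H0 : Type := WithLp 2 (L2I × L2I)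

theorem ae_μI_iff {p : ℝ → Prop} :
    (∀ᵐ x ∂μI, p x) ↔ ∀ᵐ x ∂(volume.restrict (Icc 0 π)), p x := by
  unfold μI
  rw [Measure.ae_ennreal_smul_measure_iff]
  simp [Real.pi_pos]

/-- `F` is a function, absolutely continuous on `[0, π]`, that represents the class `f` and whose
almost everywhere derivative represents the class `g`. -/
structure IsACRep (F : ℝ → ℂ) (f g : L2I) : Prop where
  absCont : AbsolutelyContinuousOnInterval F 0 π
  ae_eq : ∀ᵐ x ∂μI, f x = F x
  hasDeriv : ∀ᵐ x ∂μI, HasDerivAt F (g x) x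

theorem IsACRep.zero : IsACRep 0 0 0 where
  absCont := by
    simpa using (LipschitzOnWith.absolutelyContinuousOnInterval (f := (0 : ℝ → ℂ)) (K := 0)
      (a := 0) (b := π) ((LipschitzWith.const 0).lipschitzOnWith))
  ae_eq := Lp.coeFn_zero ℂ 2 μI
  hasDeriv := by
    filter_upwards [Lp.coeFn_zero ℂ 2 μI] with x hx
    rw [hx]
    exact hasDerivAt_const x 0

theorem IsACRep.add {F F' : ℝ → ℂ} {f f' g g' : L2I} (h : IsACRep F f g)
    (h' : IsACRep F' f' g') : IsACRep (F + F') (f + f') (g + g') where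
  absCont := h.absCont.add h'.absCont
  ae_eq := by
    filter_upwards [h.ae_eq, h'.ae_eq, Lp.coeFn_add f f'] with x h1 h2 h3
    rw [h3, Pi.add_apply, Pi.add_apply, h1, h2]
  hasDeriv := by
    filter_upwards [h.hasDeriv, h'.hasDeriv, Lp.coeFn_add g g'] with x h1 h2 h3
    rw [h3]
    exact h1.add h2

theorem IsACRep.smul (c : ℂ) {F : ℝ → ℂ} {f g : L2I} (h : IsACRep F f g) :
    IsACRep (c • F) (c • f) (c • g) where
  absCont := h.absCont.const_smul c
  ae_eq := by
    filter_upwards [h.ae_eq, Lp.coeFn_smul c f] with x h1 h2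
    rw [h2, Pi.smul_apply, Pi.smul_apply, h1]
  hasDeriv := by
    filter_upwards [h.hasDeriv, Lp.coeFn_smul c g] with x h1 h2
    rw [h2]
    exact h1.const_smul c

/-- The absolutely continuous representative is unique on `[0, π]`. -/
theorem IsACRep.eqOn {F F' : ℝ → ℂ} {f g g' : L2I} (h : IsACRep F f g)
    (h' : IsACRep F' f g') : EqOn F F' (Icc 0 π) := by
  have hc := h.absCont.continuousOn
  have hc' := h'.absCont.continuousOn
  rw [uIcc_of_le Real.pi_pos.le] at hc hc'
  refine Measure.eqOn_Icc_of_ae_eq volume Real.pi_pos.ne ?_ hc hc'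
  refine ae_μI_iff.1 ?_
  filter_upwards [h.ae_eq, h'.ae_eq] with x h1 h2
  rw [← h1, ← h2]

/-- The derivative of a Sobolev function is unique. -/
theorem IsACRep.deriv_unique {F F' : ℝ → ℂ} {f g g' : L2I} (h : IsACRep F f g)
    (h' : IsACRep F' f g') : g = g' := by
  have hI : ∀ᵐ x ∂μI, x ∈ Ioo 0 π := by
    rw [ae_μI_iff, ← restrict_Ioo_eq_restrict_Icc]
    exact ae_restrict_mem measurableSet_Ioo
  refine Lp.ext ?_
  filter_upwards [h.hasDeriv, h'.hasDeriv, hI] with x h1 h2 h3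
  refine h1.unique (h2.congr_of_eventuallyEq ?_)
  filter_upwards [isOpen_Ioo.mem_nhds h3] with t ht
  exact h.eqOn h' (Ioo_subset_Icc_self ht)

/-- The Sobolev space `W₁²([0, π])`: classes of absolutely continuous functions with derivative
in `L²`. -/
noncomputable def W12 : Submodule ℂ L2I where
  carrier := {f | ∃ (F : ℝ → ℂ) (g : L2I), IsACRep F f g}
  zero_mem' := ⟨0, 0, IsACRep.zero⟩
  add_mem' := by
    rintro _ _ ⟨F, g, h⟩ ⟨F', g', h'⟩
    exact ⟨_, _, h.add h'⟩
  smul_mem' := by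
    rintro c _ ⟨F, g, h⟩
    exact ⟨_, _, h.smul c⟩

theorem W12.exists_deriv (f : W12) : ∃ (g : L2I) (F : ℝ → ℂ), IsACRep F f g := by
  obtain ⟨F, g, h⟩ := f.2
  exact ⟨g, F, h⟩

/-- The derivative `d/dx : W₁² → L²`. -/
noncomputable def ddx : W12 →ₗ[ℂ] L2I where
  toFun f := (W12.exists_deriv f).choose
  map_add' f f' := by
    obtain ⟨F, h⟩ := (W12.exists_deriv f).choose_spec
    obtain ⟨F', h'⟩ := (W12.exists_deriv f').choose_spec
    obtain ⟨F'', h''⟩ := (W12.exists_deriv (f + f')).choose_spec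
    exact h''.deriv_unique (h.add h')
  map_smul' c f := by
    obtain ⟨F, h⟩ := (W12.exists_deriv f).choose_spec
    obtain ⟨F'', h''⟩ := (W12.exists_deriv (c • f)).choose_spec
    exact h''.deriv_unique (h.smul c)

theorem IsACRep.ddx_eq {F : ℝ → ℂ} {f g : L2I} (h : IsACRep F f g) (hf : f ∈ W12) :
    ddx ⟨f, hf⟩ = g := by
  obtain ⟨F', h'⟩ := (W12.exists_deriv ⟨f, hf⟩).choose_spec
  exact h'.deriv_unique h

/-- The product of an `L²` function and a Sobolev function is in `L²`. -/
theorem memLp_mul (P : L2I) (f : W12) :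
    MemLp (fun x => P x * (f : L2I) x) 2 μI := by
  obtain ⟨F, g, h⟩ := f.2
  obtain ⟨C, hC⟩ := h.absCont.exists_bound
  rw [uIcc_of_le Real.pi_pos.le] at hC
  have hI : ∀ᵐ x ∂μI, x ∈ Icc 0 π := by
    rw [ae_μI_iff]
    exact ae_restrict_mem measurableSet_Icc
  refine MemLp.of_le_mul (c := C) (Lp.memLp P)
    ((Lp.aestronglyMeasurable P).mul (Lp.aestronglyMeasurable _)) ?_
  filter_upwards [h.ae_eq, hI] with x h1 h2
  rw [h1, norm_mul, mul_comm]
  exact mul_le_mul_of_nonneg_right (hC x h2) (norm_nonneg _)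

/-- Multiplication by the `L²` function `P`, as an operator `W₁² → L²`. -/
noncomputable def mulBy (P : L2I) : W12 →ₗ[ℂ] L2I where
  toFun f := (memLp_mul P f).toLp _
  map_add' f f' := by
    refine Lp.ext ?_
    filter_upwards [(memLp_mul P (f + f')).coeFn_toLp, (memLp_mul P f).coeFn_toLp,
      (memLp_mul P f').coeFn_toLp, Lp.coeFn_add (f : L2I) f',
      Lp.coeFn_add ((memLp_mul P f).toLp _) ((memLp_mul P f').toLp _)] with x h1 h2 h3 h4 h5
    rw [h1, h5, Pi.add_apply, h2, h3, Submodule.coe_add, h4, Pi.add_apply, mul_add]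
  map_smul' c f := by
    refine Lp.ext ?_
    filter_upwards [(memLp_mul P (c • f)).coeFn_toLp, (memLp_mul P f).coeFn_toLp,
      Lp.coeFn_smul c (f : L2I), Lp.coeFn_smul c ((memLp_mul P f).toLp _)] with x h1 h2 h3 h4
    rw [h1, RingHom.id_apply, h4, Pi.smul_apply, h2, Submodule.coe_smul, h3, Pi.smul_apply,
      smul_eq_mul, smul_eq_mul]
    ring

/-! ### Boundary conditions and the Dirac operator -/

/-- The three kinds of boundary conditions `Per⁺`, `Per⁻`, `Dir`. -/
inductive BC : Type
  | periodic
  | antiperiodic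
  | dirichlet

/-- The boundary condition for a vector function `(F₁, F₂)` on `[0, π]`. -/
def BC.Holds (bc : BC) (F₁ F₂ : ℝ → ℂ) : Prop :=
  match bc with
  | .periodic => F₁ 0 = F₁ π ∧ F₂ 0 = F₂ π
  | .antiperiodic => F₁ 0 = -F₁ π ∧ F₂ 0 = -F₂ π
  | .dirichlet => F₁ 0 = F₂ 0 ∧ F₁ π = F₂ π

/-- The domain: all `y ∈ (W₁²)²` whose continuous representative satisfies the boundary
condition. -/
noncomputable def diracDomain (bc : BC) : Submodule ℂ H0 where
  carrier := {y | ∃ (F₁ F₂ : ℝ → ℂ) (g₁ g₂ : L2I),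
    IsACRep F₁ y.fst g₁ ∧ IsACRep F₂ y.snd g₂ ∧ bc.Holds F₁ F₂}
  zero_mem' := by
    refine ⟨0, 0, 0, 0, IsACRep.zero, IsACRep.zero, ?_⟩
    cases bc <;> simp [BC.Holds]
  add_mem' := by
    rintro y y' ⟨F₁, F₂, g₁, g₂, h₁, h₂, hb⟩ ⟨F₁', F₂', g₁', g₂', h₁', h₂', hb'⟩
    refine ⟨_, _, _, _, h₁.add h₁', h₂.add h₂', ?_⟩
    cases bc <;> simp only [BC.Holds, Pi.add_apply] at hb hb' ⊢ <;>
      rw [hb.1, hb.2, hb'.1, hb'.2] <;> constructor <;> ring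
  smul_mem' := by
    rintro c y ⟨F₁, F₂, g₁, g₂, h₁, h₂, hb⟩
    refine ⟨_, _, _, _, h₁.smul c, h₂.smul c, ?_⟩
    cases bc <;> simp only [BC.Holds, Pi.smul_apply, smul_eq_mul] at hb ⊢ <;>
      rw [hb.1, hb.2] <;> constructor <;> ring

/-- The first component of an element of the domain, as a Sobolev function. -/
noncomputable def compFst (bc : BC) : diracDomain bc →ₗ[ℂ] W12 where
  toFun y := ⟨(y : H0).fst, by
    obtain ⟨F₁, F₂, g₁, g₂, h₁, h₂, hb⟩ := y.2
    exact ⟨F₁, g₁, h₁⟩⟩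
  map_add' _ _ := rfl
  map_smul' _ _ := rfl

/-- The second component of an element of the domain, as a Sobolev function. -/
noncomputable def compSnd (bc : BC) : diracDomain bc →ₗ[ℂ] W12 where
  toFun y := ⟨(y : H0).snd, by
    obtain ⟨F₁, F₂, g₁, g₂, h₁, h₂, hb⟩ := y.2
    exact ⟨F₂, g₂, h₂⟩⟩
  map_add' _ _ := rfl
  map_smul' _ _ := rfl

/-- The Dirac operator `L y = i diag(1, -1) y' + v y` with `v` having zero diagonal and
off-diagonal entries `P` (upper right) and `Q` (lower left), on the domain given by the boundary
condition. -/
noncomputable def dirac (bc : BC) (P Q : L2I) : H0 →ₗ.[ℂ] H0 where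
  domain := diracDomain bc
  toFun :=
    { toFun := fun y => WithLp.toLp 2
        (Complex.I • ddx (compFst bc y) + mulBy P (compSnd bc y),
          -Complex.I • ddx (compSnd bc y) + mulBy Q (compFst bc y))
      map_add' := fun y y' => by
        rw [← WithLp.toLp_add, Prod.mk_add_mk]
        simp only [map_add, smul_add]
        congr 2 <;> abel
      map_smul' := fun c y => by
        rw [RingHom.id_apply, ← WithLp.toLp_smul, Prod.smul_mk]
        simp only [map_smul, smul_add]
        rw [smul_comm c Complex.I, smul_comm c (-Complex.I)] }

/-- The free Dirac operator (`P = Q = 0`). -/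
noncomputable def freeDirac (bc : BC) : H0 →ₗ.[ℂ] H0 := dirac bc 0 0

end DiracOp

/-! Write `V` for multiplication by `v`, `R₀ = (z - L⁰)⁻¹` and `S = V R₀`. Then `z - L = (1 - S)(z -
L⁰)`, so `R = R₀ (1 - S)⁻¹` and `R - R₀ = R₀ S (1 - S)⁻¹`. On the circles `|z - n| = 1/2` the
operator `S` is bounded uniformly in `n` but need not be small. Small for large `|n|` are `R₀ S` and
`S²`, and that suffices, because `(1 - S)⁻¹ = (1 + S)(1 - S²)⁻¹` (`IsResolventAt.exists_perturb`).

Smallness comes from oscillation. The free solutions behave like `e^{-izx}` in the first component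
and `e^{izx}` in the second, and `V` interchanges the components. In `R₀ V R₀ f` the exponentials
therefore add up instead of cancelling: `P` is integrated against `e^{2izt}` and `Q` against
`e^{-2izt}`. Integration by parts bounds these integrals by `osc n P` and `osc (-n) Q`
(`norm_integral_exp_mul_duhamel_le`), whence a pointwise bound for `R₀ V R₀ f`
(`IsFreeSolution.second_order_bound`). The boundary conditions enter only through initial values,
controlled by a lower bound for `|e^{2πiz} - 1|` that is uniform in `n`.

For each `x`, `osc n P x` is `π` times a Fourier coefficient of `P` cut off at `x`, so Bessel gives
`∑ |osc n P x|² ≤ π² ‖P‖²` uniformly in `x`. This may be integrated against any integrable weight,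
in particular `1 + |P|² + |Q|²`, hence `∑ oscEnergy P Q n < ∞`. Since `‖R - R₀‖ ≤ L √(oscEnergy P Q
n)` on the circle once the energy is small, the same holds for the projections up to a factor, and
the squares are summable. -/

namespace DiracOp

/-! ### Resolvents of unbounded operators and their perturbation. -/

section AbstractResolvent

variable {E : Type*} [NormedAddCommGroup E] [NormedSpace ℂ E]

/-- The first resolvent identity. -/
theorem IsResolventAt.sub_eq {A : E →ₗ.[ℂ] E} {z w : ℂ} {R R' : E →L[ℂ] E}
    (h : IsResolventAt A z R) (h' : IsResolventAt A w R') :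
    R' - R = (z - w) • (R' ∘L R) := by
  ext f
  obtain ⟨y, hy, hf⟩ := h.1 f
  have h1 := h'.2 y
  have h2 : w • (y : E) - A y = f - (z - w) • (y : E) := by
    rw [← hf, sub_smul]; abel
  rw [h2, map_sub, map_smul] at h1
  have h3 : R' f = y + (z - w) • R' y := sub_eq_iff_eq_add.1 h1
  change R' f - R f = (z - w) • R' (R f)
  rw [← hy, h3]
  abel

/-- The resolvent identity gives `‖T - R‖ ≤ |z - w| ‖T‖ ‖R‖`; for `|z - w| ‖R‖ ≤ 1/2` half of `‖T‖`
is absorbed, so `‖T‖ ≤ 2 ‖R‖`. This makes integrability along a circle automatic once the circle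
lies in the resolvent set. -/
theorem continuousOn_unbddResolvent (A : E →ₗ.[ℂ] E) :
    ContinuousOn (unbddResolvent A) (unbddResolventSet A) := by
  intro z hz
  set R := unbddResolvent A z with hR
  have key : ∀ w ∈ unbddResolventSet A, ‖z - w‖ * ‖R‖ ≤ 1 / 2 →
      ‖unbddResolvent A w - R‖ ≤ ‖z - w‖ * (2 * ‖R‖ * ‖R‖) := by
    intro w hw hzw
    have h := (isResolventAt_unbddResolvent hz).sub_eq (isResolventAt_unbddResolvent hw)
    rw [← hR] at h
    set T := unbddResolvent A w
    have h1 : ‖T - R‖ ≤ ‖z - w‖ * (‖T‖ * ‖R‖) := by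
      rw [h, norm_smul]
      gcongr
      exact ContinuousLinearMap.opNorm_comp_le _ _
    have h2 : ‖T‖ ≤ ‖R‖ + ‖T - R‖ := by
      simpa using norm_add_le R (T - R)
    have h3 : ‖T‖ ≤ 2 * ‖R‖ := by
      nlinarith [norm_nonneg T]
    refine h1.trans ?_
    gcongr
  rw [ContinuousWithinAt, tendsto_iff_norm_sub_tendsto_zero]
  have hc : Filter.Tendsto (fun w : ℂ => ‖z - w‖) (nhdsWithin z (unbddResolventSet A))
      (nhds 0) := by
    have : ContinuousAt (fun w : ℂ => ‖z - w‖) z := by fun_prop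
    simpa using this.tendsto.mono_left nhdsWithin_le_nhds
  have hsmall := (hc.mul_const ‖R‖).eventually_le_const (u := 1 / 2) (by norm_num)
  refine squeeze_zero' (Filter.Eventually.of_forall fun _ => norm_nonneg _) ?_
    (by simpa using hc.mul_const (2 * ‖R‖ * ‖R‖))
  filter_upwards [hsmall, self_mem_nhdsWithin] with w h1 h2
  exact key w h2 h1

theorem rieszWellDefined_of_subset {A : E →ₗ.[ℂ] E} {c : ℂ} {r : ℝ} (hr : 0 ≤ r)
    (h : Metric.sphere c r ⊆ unbddResolventSet A) : RieszWellDefined A c r :=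
  ⟨h, ContinuousOn.circleIntegrable hr ((continuousOn_unbddResolvent A).mono h)⟩

/-- The length `2πr` of the circle against the prefactor `1/(2π)` leaves `r`. -/
theorem norm_rieszProj_sub_le {A A' : E →ₗ.[ℂ] E} {c : ℂ} {r C : ℝ} (hr : 0 ≤ r)
    (h : RieszWellDefined A c r) (h' : RieszWellDefined A' c r)
    (hC : ∀ z ∈ Metric.sphere c r, ‖unbddResolvent A z - unbddResolvent A' z‖ ≤ C) :
    ‖rieszProj A c r - rieszProj A' c r‖ ≤ r * C := by
  unfold rieszProj
  rw [← smul_sub, ← circleIntegral.integral_sub h.2 h'.2, norm_smul]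
  have h1 := circleIntegral.norm_integral_le_of_norm_le_const hr hC
  have h2 : ‖(2 * (π : ℂ) * Complex.I)⁻¹‖ = (2 * π)⁻¹ := by
    simp [abs_of_pos Real.pi_pos]
  rw [h2, inv_mul_le_iff₀ (by positivity)]
  linarith

theorem mem_unbddResolventSet_of_bound {A : E →ₗ.[ℂ] E} {z : ℂ} {C : ℝ}
    (hs : ∀ f : E, ∃ y : A.domain, z • (y : E) - A y = f)
    (hb : ∀ y : A.domain, ‖(y : E)‖ ≤ C * ‖z • (y : E) - A y‖) :
    z ∈ unbddResolventSet A := by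
  let T : A.domain →ₗ[ℂ] E := z • A.domain.subtype - A.toFun
  have hT : ∀ y : A.domain, T y = z • (y : E) - A y := fun y => rfl
  have hinj : Function.Injective T := by
    refine (injective_iff_map_eq_zero T).2 fun y hy => ?_
    have := hb y
    rw [← hT, hy, norm_zero, mul_zero] at this
    exact Subtype.ext (norm_le_zero_iff.1 this)
  let e := LinearEquiv.ofBijective T ⟨hinj, hs⟩
  have he : ∀ f, T (e.symm f) = f := fun f => e.apply_symm_apply f
  refine ⟨(A.domain.subtype ∘ₗ e.symm.toLinearMap).mkContinuous C fun f => ?_,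
    fun f => ⟨e.symm f, rfl, by rw [← hT, he]⟩, fun y => ?_⟩
  · have := hb (e.symm f)
    rw [← hT, he] at this
    exact this
  · have : e.symm (T y) = y := e.symm_apply_apply y
    change ((e.symm (T y) : A.domain) : E) = y
    rw [this]

/-- Perturbation of the resolvent of `A₀` by an operator `B` such that `B (z - A₀)⁻¹` is bounded
and has a small square. -/
theorem IsResolventAt.exists_perturb [CompleteSpace E] {D : Submodule ℂ E} {A₀ A B : D →ₗ[ℂ] E}
    (hA : ∀ y, A y = A₀ y + B y) {z : ℂ} {R₀ : E →L[ℂ] E}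
    (h₀ : IsResolventAt (LinearPMap.mk D A₀) z R₀) {C δ : ℝ} (hC0 : 0 ≤ C)
    (hC : ∀ y : D, ‖B y‖ ≤ C * ‖z • (y : E) - A₀ y‖)
    (hδ : ∀ y w : D, z • (w : E) - A₀ w = B y →
      ‖(w : E)‖ ≤ δ * ‖z • (y : E) - A₀ y‖ ∧ ‖B w‖ ≤ δ * ‖z • (y : E) - A₀ y‖)
    (hδ0 : 0 ≤ δ) (hδ1 : δ ≤ 1 / 2) :
    ∃ R : E →L[ℂ] E, IsResolventAt (LinearPMap.mk D A) z R ∧ ‖R - R₀‖ ≤ δ * (2 * (1 + C)) := by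
  have hmem : ∀ f, R₀ f ∈ D := fun f => by
    obtain ⟨y, hy, -⟩ := h₀.1 f
    rw [← hy]; exact y.2
  let L : E →ₗ[ℂ] D := R₀.toLinearMap.codRestrict D hmem
  have hL : ∀ f, (L f : E) = R₀ f := fun f => rfl
  have hLf : ∀ f, z • (L f : E) - A₀ (L f) = f := fun f => by
    obtain ⟨y, hy, hf⟩ := h₀.1 f
    have : L f = y := Subtype.ext (by rw [hL, hy])
    rw [this]; exact hf
  have hLy : ∀ y : D, L (z • (y : E) - A₀ y) = y := fun y => Subtype.ext (h₀.2 y)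
  -- `S = B (z - A₀)⁻¹`, so that `z - A = (1 - S)(z - A₀)`. Taking `w = L (S f)` in `hδ` bounds both
  -- `R₀ S` and `S²` by `δ`, while `S` itself is only bounded by `C`.
  let S : E →L[ℂ] E := (B ∘ₗ L).mkContinuous C fun f => by
    have := hC (L f)
    rwa [hLf] at this
  have hS : ∀ f, S f = B (L f) := fun f => rfl
  have hSn : ∀ f, ‖S f‖ ≤ C * ‖f‖ := fun f => by
    have := hC (L f)
    rwa [hLf] at this
  have hRS : ∀ f, ‖R₀ (S f)‖ ≤ δ * ‖f‖ := fun f => by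
    have := (hδ (L f) (L (S f)) (by rw [hLf, hS])).1
    rwa [hLf] at this
  have hSS : ∀ f, ‖S (S f)‖ ≤ δ * ‖f‖ := fun f => by
    have := (hδ (L f) (L (S f)) (by rw [hLf, hS])).2
    rwa [hLf] at this
  have hn : ‖S * S‖ < 1 :=
    (ContinuousLinearMap.opNorm_le_bound _ hδ0 hSS).trans_lt (by linarith)
  obtain ⟨u, hu⟩ : IsUnit (1 - S * S) := (Units.oneSub _ hn).isUnit
  -- `W` is the inverse of `1 - S`, from `(1 - S)(1 + S) = 1 - S²`; the unit `u = 1 - S²` commutes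
  -- with `1 - S`.
  set W : E →L[ℂ] E := (1 + S) * ↑u⁻¹ with hW
  have e1 : (1 - S) * W = 1 := by
    have : (1 - S) * (1 + S) = 1 - S * S := by noncomm_ring
    rw [hW, ← mul_assoc, this, ← hu, Units.mul_inv]
  have e2 : W * (1 - S) = 1 := by
    have hc : (↑u : E →L[ℂ] E) * (1 - S) = (1 - S) * u := by rw [hu]; noncomm_ring
    have hc' : (↑u⁻¹ : E →L[ℂ] E) * (1 - S) = (1 - S) * ↑u⁻¹ := by
      calc (↑u⁻¹ : E →L[ℂ] E) * (1 - S) = ↑u⁻¹ * ((1 - S) * u) * ↑u⁻¹ := by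
            rw [mul_assoc, mul_assoc, Units.mul_inv, mul_one]
        _ = (1 - S) * ↑u⁻¹ := by rw [← hc, ← mul_assoc, Units.inv_mul, one_mul]
    have : (1 + S) * (1 - S) = 1 - S * S := by noncomm_ring
    rw [hW, mul_assoc, hc', ← mul_assoc, this, ← hu, Units.mul_inv]
  have w1 : ∀ f, W f = f + S (W f) := fun f => by
    have h1 : W f - S (W f) = f := congrArg (fun T : E →L[ℂ] E => T f) e1
    exact sub_eq_iff_eq_add.1 h1
  have w2 : ∀ f, W (f - S f) = f := fun f => congrArg (fun T : E →L[ℂ] E => T f) e2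
  -- Iterating `W = 1 + S W` once gives `W = 1 + S + S² W`, and `δ ≤ 1/2` absorbs the last term.
  have hWn : ∀ f, ‖W f‖ ≤ 2 * (1 + C) * ‖f‖ := fun f => by
    have h1 : W f = f + S f + S (S (W f)) := by
      conv_lhs => rw [w1, w1 f, map_add]
      abel
    have h2 : ‖W f‖ ≤ ‖f‖ + C * ‖f‖ + δ * ‖W f‖ := by
      conv_lhs => rw [h1]
      exact (norm_add_le _ _).trans (add_le_add ((norm_add_le _ _).trans
        (add_le_add le_rfl (hSn f))) (hSS _))
    nlinarith [norm_nonneg (W f)]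
  refine ⟨R₀ * W, ⟨fun f => ⟨L (W f), rfl, ?_⟩, fun y => ?_⟩, ?_⟩
  · change z • (L (W f) : E) - A (L (W f)) = f
    rw [hA, ← sub_sub, hLf, ← hS, sub_eq_iff_eq_add]
    exact w1 f
  · change R₀ (W (z • (y : E) - A y)) = y
    have : z • (y : E) - A y = (z • (y : E) - A₀ y) - S (z • (y : E) - A₀ y) := by
      rw [hS, hLy, hA, sub_sub]
    rw [this, w2]
    exact h₀.2 y
  · refine ContinuousLinearMap.opNorm_le_bound _ (by positivity) fun f => ?_
    have : (R₀ * W - R₀) f = R₀ (S (W f)) := by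
      change R₀ (W f) - R₀ f = _
      conv_lhs => rw [w1, map_add]
      abel
    rw [this, mul_assoc]
    exact (hRS _).trans (mul_le_mul_of_nonneg_left (hWn f) hδ0)

end AbstractResolvent

/-! ### Integration on `[0, π]` -/

instance isProbabilityMeasure_μI : IsProbabilityMeasure μI := by
  constructor
  rw [μI, Measure.smul_apply, Measure.restrict_apply_univ, Real.volume_Icc, sub_zero,
    smul_eq_mul, ← ENNReal.ofReal_mul (by positivity), inv_mul_cancel₀ Real.pi_pos.ne',
    ENNReal.ofReal_one]

theorem ae_mem_Icc_μI : ∀ᵐ x ∂μI, x ∈ Icc 0 π :=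
  ae_μI_iff.2 (ae_restrict_mem measurableSet_Icc)

theorem ae_μI_of_ae {p : ℝ → Prop} (h : ∀ᵐ x, x ∈ Icc 0 π → p x) : ∀ᵐ x ∂μI, p x :=
  ae_μI_iff.2 ((ae_restrict_iff' measurableSet_Icc).2 h)

theorem ae_of_ae_μI {p : ℝ → Prop} (h : ∀ᵐ x ∂μI, p x) : ∀ᵐ x, x ∈ Icc 0 π → p x :=
  (ae_restrict_iff' measurableSet_Icc).1 (ae_μI_iff.1 h)

theorem integrable_μI_iff {F : Type*} [NormedAddCommGroup F] {g : ℝ → F} :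
    Integrable g μI ↔ IntervalIntegrable g volume 0 π := by
  rw [intervalIntegrable_iff_integrableOn_Icc_of_le Real.pi_pos.le, IntegrableOn, μI,
    integrable_smul_measure (by simp [Real.pi_pos]) ENNReal.ofReal_ne_top]

theorem intervalIntegral_eq_integral_μI {F : Type*} [NormedAddCommGroup F] [NormedSpace ℝ F]
    (g : ℝ → F) : ∫ t in 0..π, g t = π • ∫ t, g t ∂μI := by
  rw [intervalIntegral.integral_of_le Real.pi_pos.le, ← integral_Icc_eq_integral_Ioc, μI,
    integral_smul_measure, ENNReal.toReal_ofReal (by positivity), smul_smul,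
    mul_inv_cancel₀ Real.pi_pos.ne', one_smul]

theorem uIcc_zero_pi : uIcc 0 π = Icc 0 π := uIcc_of_le Real.pi_pos.le

theorem zero_mem_Icc_pi : (0 : ℝ) ∈ Icc 0 π := ⟨le_rfl, Real.pi_pos.le⟩

theorem pi_mem_Icc_pi : π ∈ Icc 0 π := ⟨Real.pi_pos.le, le_rfl⟩

theorem IntervalIntegrable.mono_zero_pi {F : Type*} [NormedAddCommGroup F] {g : ℝ → F}
    (hg : IntervalIntegrable g volume 0 π) {x : ℝ} (hx : x ∈ Icc 0 π) :
    IntervalIntegrable g volume 0 x :=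
  hg.mono_set (by rw [uIcc_of_le hx.1, uIcc_zero_pi]; exact Icc_subset_Icc_right hx.2)

/-- A partial integral is bounded by the full integral of a majorant. -/
theorem norm_intervalIntegral_le {g : ℝ → ℂ} {G : ℝ → ℝ} (hG : Integrable G μI)
    (h : ∀ᵐ t ∂μI, ‖g t‖ ≤ G t) {x : ℝ} (hx : x ∈ Icc 0 π) :
    ‖∫ t in 0..x, g t‖ ≤ π * ∫ t, G t ∂μI := by
  have hGi := integrable_μI_iff.1 hG
  have h' := ae_of_ae_μI h
  calc ‖∫ t in 0..x, g t‖ ≤ ∫ t in 0..x, G t := by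
        refine intervalIntegral.norm_integral_le_of_norm_le hx.1 ?_
          (IntervalIntegrable.mono_zero_pi hGi hx)
        filter_upwards [h'] with t ht htx
        exact ht ⟨htx.1.le, htx.2.trans hx.2⟩
    _ ≤ ∫ t in 0..π, G t := by
        refine intervalIntegral.integral_mono_interval le_rfl hx.1 hx.2 ?_ hGi
        refine (ae_restrict_iff' measurableSet_Ioc).2 ?_
        filter_upwards [h'] with t ht htx
        exact (norm_nonneg _).trans (ht (Ioc_subset_Icc_self htx))
    _ = _ := by rw [intervalIntegral_eq_integral_μI, smul_eq_mul]

theorem norm_sq_L2I (f : L2I) : ‖f‖ ^ 2 = ∫ t, ‖f t‖ ^ 2 ∂μI := by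
  have h := L2.inner_def (𝕜 := ℂ) f f
  rw [inner_self_eq_norm_sq_to_K] at h
  have h2 : (∫ t, inner ℂ (f t) (f t) ∂μI) = ((∫ t, ‖f t‖ ^ 2 ∂μI : ℝ) : ℂ) := by
    rw [← integral_complex_ofReal]
    congr 1 with t
    rw [inner_self_eq_norm_sq_to_K]
    simp
  rw [h2] at h
  apply Complex.ofReal_injective
  rw [Complex.ofReal_pow]
  exact h

theorem integrable_norm_sq (f : L2I) : Integrable (fun t => ‖f t‖ ^ 2) μI :=
  (memLp_two_iff_integrable_sq_norm (Lp.aestronglyMeasurable f)).1 (Lp.memLp f)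

theorem integrable_L2I (f : L2I) : Integrable f μI := (Lp.memLp f).integrable one_le_two

theorem integral_mul_le_sqrt {f g : ℝ → ℝ} (hf0 : 0 ≤ᵐ[μI] f) (hg0 : 0 ≤ᵐ[μI] g)
    (hf : MemLp f 2 μI) (hg : MemLp g 2 μI) :
    ∫ t, f t * g t ∂μI ≤ √(∫ t, f t ^ 2 ∂μI) * √(∫ t, g t ^ 2 ∂μI) := by
  have h := integral_mul_le_Lp_mul_Lq_of_nonneg Real.HolderConjugate.two_two hf0 hg0
    (by simpa using hf) (by simpa using hg)
  simpa [Real.sqrt_eq_rpow] using h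

theorem integral_norm_mul_le {g : ℝ → ℝ} (hg0 : 0 ≤ᵐ[μI] g) (hg : MemLp g 2 μI) (f : L2I) :
    ∫ t, g t * ‖f t‖ ∂μI ≤ √(∫ t, g t ^ 2 ∂μI) * ‖f‖ := by
  have h := integral_mul_le_sqrt hg0 (Filter.Eventually.of_forall fun t => norm_nonneg (f t)) hg
    (Lp.memLp f).norm
  rwa [← norm_sq_L2I, Real.sqrt_sq (norm_nonneg _)] at h

theorem integral_norm_le (f : L2I) : ∫ t, ‖f t‖ ∂μI ≤ ‖f‖ := by
  simpa using integral_norm_mul_le (g := fun _ => 1) (Filter.Eventually.of_forall fun _ =>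
    zero_le_one) (memLp_const 1) f

theorem norm_L2I_le_of_sq {f : L2I} {C : ℝ} {G : ℝ → ℝ} (hC : 0 ≤ C) (hG : Integrable G μI)
    (h : ∀ᵐ t ∂μI, ‖f t‖ ^ 2 ≤ C ^ 2 * G t) : ‖f‖ ≤ C * √(∫ t, G t ∂μI) := by
  have h1 : ‖f‖ ^ 2 ≤ C ^ 2 * ∫ t, G t ∂μI := by
    rw [norm_sq_L2I, ← integral_const_mul]
    exact integral_mono_ae (integrable_norm_sq f) (hG.const_mul _) h
  have h2 := Real.sqrt_le_sqrt h1
  rwa [Real.sqrt_sq (norm_nonneg _), Real.sqrt_mul (sq_nonneg _), Real.sqrt_sq hC] at h2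

/-! ### Absolutely continuous functions with integrable derivative -/

/-- `F` is absolutely continuous on `[0, π]`, with integrable almost everywhere derivative `f`. -/
structure HasACDeriv (F f : ℝ → ℂ) : Prop where
  absCont : AbsolutelyContinuousOnInterval F 0 π
  integrable : IntervalIntegrable f volume 0 π
  hasDeriv : ∀ᵐ x ∂μI, HasDerivAt F (f x) x

theorem absolutelyContinuousOnInterval_const (c : ℂ) (a b : ℝ) :
    AbsolutelyContinuousOnInterval (fun _ => c) a b :=
  LipschitzOnWith.absolutelyContinuousOnInterval (K := 0) (LipschitzWith.const c).lipschitzOnWith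

/-- Increments of the integral of `g` are dominated by those of the integral of `‖g‖`, so the same
`δ` serves. -/
theorem absolutelyContinuousOnInterval_integral {g : ℝ → ℂ}
    (hg : IntervalIntegrable g volume 0 π) :
    AbsolutelyContinuousOnInterval (fun x => ∫ t in 0..x, g t) 0 π := by
  have hN := hg.norm.absolutelyContinuousOnInterval_intervalIntegral
    (c := 0) (by rw [uIcc_zero_pi]; exact zero_mem_Icc_pi)
  rw [absolutelyContinuousOnInterval_iff] at hN ⊢
  intro ε hε
  obtain ⟨δ, hδ, H⟩ := hN ε hε
  refine ⟨δ, hδ, fun E hE hs => lt_of_le_of_lt (Finset.sum_le_sum fun i hi => ?_) (H E hE hs)⟩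
  have hi' := hE.1 i hi
  have i1 : ∀ {G : Type} [NormedAddCommGroup G] (k : ℝ → G), IntervalIntegrable k volume 0 π →
      ∀ y ∈ uIcc 0 π, IntervalIntegrable k volume 0 y := fun k hk y hy =>
    IntervalIntegrable.mono_zero_pi hk (by rwa [uIcc_zero_pi] at hy)
  rw [dist_comm, dist_comm (∫ t in 0..(E.2 i).1, ‖g t‖), dist_eq_norm, Real.dist_eq,
    intervalIntegral.integral_interval_sub_left (i1 g hg _ hi'.2) (i1 g hg _ hi'.1),
    intervalIntegral.integral_interval_sub_left (i1 _ hg.norm _ hi'.2) (i1 _ hg.norm _ hi'.1)]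
  exact intervalIntegral.norm_integral_le_abs_integral_norm

theorem hasACDeriv_integral {g : ℝ → ℂ} (hg : IntervalIntegrable g volume 0 π) (c : ℂ) :
    HasACDeriv (fun x => c + ∫ t in 0..x, g t) g where
  absCont := (absolutelyContinuousOnInterval_const c 0 π).add
    (absolutelyContinuousOnInterval_integral hg)
  integrable := hg
  hasDeriv := by
    have h := hg.ae_hasDerivAt_integral
    rw [uIcc_zero_pi] at h
    refine ae_μI_of_ae ?_
    filter_upwards [h] with x hx hxI
    exact (hx hxI 0 zero_mem_Icc_pi).const_add c

theorem hasACDeriv_exp (a : ℂ) :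
    HasACDeriv (fun x => Complex.exp (a * x)) (fun x => Complex.exp (a * x) * a) where
  absCont := by
    refine ContDiffOn.absolutelyContinuousOnInterval (ContDiff.contDiffOn ?_)
    exact (contDiff_const.mul Complex.ofRealCLM.contDiff).cexp
  integrable := Continuous.intervalIntegrable (by fun_prop) _ _
  hasDeriv := Filter.Eventually.of_forall fun x => by
    have h := ((hasDerivAt_id (x : ℂ)).const_mul a).cexp.comp_ofReal
    simpa using h

namespace HasACDeriv

variable {F G f g : ℝ → ℂ}

theorem continuousOn (h : HasACDeriv F f) : ContinuousOn F (Icc 0 π) := by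
  have := h.absCont.continuousOn
  rwa [uIcc_zero_pi] at this

theorem mul (h : HasACDeriv F f) (h' : HasACDeriv G g) :
    HasACDeriv (fun x => F x * G x) (fun x => f x * G x + F x * g x) where
  absCont := h.absCont.smul h'.absCont
  integrable := (h.integrable.mul_continuousOn h'.absCont.continuousOn).add
    (h'.integrable.continuousOn_mul h.absCont.continuousOn)
  hasDeriv := by
    filter_upwards [h.hasDeriv, h'.hasDeriv] with x h1 h2
    exact h1.mul h2

theorem congr_deriv (h : HasACDeriv F f) (hfg : ∀ᵐ x ∂μI, f x = g x) : HasACDeriv F g where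
  absCont := h.absCont
  integrable := integrable_μI_iff.1 ((integrable_μI_iff.2 h.integrable).congr hfg)
  hasDeriv := by
    filter_upwards [h.hasDeriv, hfg] with x h1 h2
    rwa [← h2]

/-- The fundamental theorem of calculus for absolutely continuous functions. -/
theorem eq_integral (h : HasACDeriv F f) {x : ℝ} (hx : x ∈ Icc 0 π) :
    F x = F 0 + ∫ t in 0..x, f t := by
  have hI := hasACDeriv_integral h.integrable 0
  -- `F` minus the integral of its derivative is absolutely continuous with derivative zero almost
  -- everywhere, hence constant.
  obtain ⟨C, hC⟩ := (h.absCont.sub hI.absCont).const_of_ae_hasDerivAt_zero (by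
    rw [uIcc_zero_pi]
    refine ae_of_ae_μI ?_
    filter_upwards [h.hasDeriv, hI.hasDeriv] with x h1 h2
    simpa using h1.sub h2)
  rw [uIcc_zero_pi] at hC
  have h0 := hC 0 zero_mem_Icc_pi
  have h1 := hC x hx
  simp only [Pi.sub_apply, intervalIntegral.integral_same, zero_add, sub_zero] at h0 h1
  rw [h0, ← h1]
  abel

end HasACDeriv

theorem IsACRep.hasACDeriv {F : ℝ → ℂ} {f g : L2I} (h : IsACRep F f g) : HasACDeriv F g where
  absCont := h.absCont
  integrable := integrable_μI_iff.1 (integrable_L2I g)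
  hasDeriv := h.hasDeriv

/-! ### The scalar first order equation -/

theorem aestronglyMeasurable_of_continuousOn {F : Type*} [NormedAddCommGroup F] {g : ℝ → F}
    (hg : ContinuousOn g (Icc 0 π)) : AEStronglyMeasurable g μI :=
  (hg.aestronglyMeasurable_of_isCompact isCompact_Icc measurableSet_Icc).smul_measure _

theorem memLp_of_continuousOn {F : Type*} [NormedAddCommGroup F] {g : ℝ → F}
    (hg : ContinuousOn g (Icc 0 π)) : MemLp g 2 μI := by
  obtain ⟨C, hC⟩ := isCompact_Icc.exists_bound_of_continuousOn hg
  exact MemLp.of_bound (aestronglyMeasurable_of_continuousOn hg) C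
    (ae_mem_Icc_μI.mono fun x hx => hC x hx)

/-- The solution of `F' = a F + k` with `F 0 = c`. -/
noncomputable def duhamel (a c : ℂ) (k : ℝ → ℂ) (x : ℝ) : ℂ :=
  Complex.exp (a * x) * (c + ∫ t in 0..x, Complex.exp (-a * t) * k t)

@[simp] theorem duhamel_zero (a c : ℂ) (k : ℝ → ℂ) : duhamel a c k 0 = c := by
  simp [duhamel]

theorem intervalIntegrable_exp_mul (a : ℂ) {k : ℝ → ℂ} (hk : IntervalIntegrable k volume 0 π) :
    IntervalIntegrable (fun t : ℝ => Complex.exp (a * t) * k t) volume 0 π :=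
  hk.continuousOn_mul (by fun_prop)

theorem L2I.intervalIntegrable (k : L2I) : IntervalIntegrable k volume 0 π :=
  integrable_μI_iff.1 (integrable_L2I k)

theorem exp_mul_exp_neg (a : ℂ) (x : ℝ) : Complex.exp (a * x) * Complex.exp (-a * x) = 1 := by
  rw [← Complex.exp_add]; simp

theorem hasACDeriv_duhamel (a c : ℂ) {k : ℝ → ℂ} (hk : IntervalIntegrable k volume 0 π) :
    HasACDeriv (duhamel a c k) (fun x => a * duhamel a c k x + k x) := by
  refine ((hasACDeriv_exp a).mul
    (hasACDeriv_integral (intervalIntegrable_exp_mul (-a) hk) c)).congr_deriv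
    (Filter.Eventually.of_forall fun x => ?_)
  simp only [duhamel]
  linear_combination (k x) * exp_mul_exp_neg a x

/-- Uniqueness for the initial value problem, by the integrating factor `e^{-ax}`. -/
theorem HasACDeriv.eq_duhamel {F f k : ℝ → ℂ} {a : ℂ} (h : HasACDeriv F f)
    (hf : ∀ᵐ x ∂μI, f x = a * F x + k x) {x : ℝ} (hx : x ∈ Icc 0 π) :
    F x = duhamel a (F 0) k x := by
  have h1 := ((hasACDeriv_exp (-a)).mul h).congr_deriv
    (g := fun x => Complex.exp (-a * x) * k x) (by
      filter_upwards [hf] with x hx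
      rw [hx]; ring)
  have h2 := h1.eq_integral hx
  simp only [Complex.ofReal_zero, mul_zero, Complex.exp_zero, one_mul] at h2
  rw [duhamel, ← h2, ← mul_assoc, exp_mul_exp_neg, one_mul]

theorem exists_isACRep_duhamel (a c : ℂ) (k : L2I) :
    ∃ y : L2I, IsACRep (duhamel a c k) y (a • y + k) := by
  have hd := hasACDeriv_duhamel a c k.intervalIntegrable
  have hm := memLp_of_continuousOn hd.continuousOn
  refine ⟨hm.toLp _, hd.absCont, hm.coeFn_toLp, ?_⟩
  filter_upwards [hd.hasDeriv, hm.coeFn_toLp, Lp.coeFn_add (a • hm.toLp _) k,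
    Lp.coeFn_smul a (hm.toLp _)] with x h1 h2 h3 h4
  rw [h3, Pi.add_apply, h4, Pi.smul_apply, h2, smul_eq_mul]
  exact h1

theorem norm_exp_mul_le {a : ℂ} (ha : |a.re| ≤ 1) {t : ℝ} (ht : t ∈ Icc 0 π) :
    ‖Complex.exp (a * t)‖ ≤ Real.exp π := by
  rw [Complex.norm_exp, Real.exp_le_exp]
  simp only [Complex.mul_re, Complex.ofReal_re, Complex.ofReal_im, mul_zero, sub_zero]
  calc a.re * t ≤ 1 * t := mul_le_mul_of_nonneg_right ((le_abs_self _).trans ha) ht.1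
    _ ≤ π := by rw [one_mul]; exact ht.2

theorem norm_integral_exp_mul_le {a : ℂ} (ha : |a.re| ≤ 1) (k : L2I) {x : ℝ}
    (hx : x ∈ Icc 0 π) :
    ‖∫ t in 0..x, Complex.exp (a * t) * k t‖ ≤ π * Real.exp π * ‖k‖ := by
  have h := norm_intervalIntegral_le (g := fun t : ℝ => Complex.exp (a * t) * k t)
    (G := fun t => Real.exp π * ‖k t‖) ((integrable_L2I k).norm.const_mul _) (by
      filter_upwards [ae_mem_Icc_μI] with t ht
      rw [norm_mul]
      gcongr
      exact norm_exp_mul_le ha ht) hx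
  rw [integral_const_mul] at h
  refine h.trans ?_
  rw [mul_assoc]
  gcongr
  exact integral_norm_le k

/-- A constant for the growth of solutions on `[0, π]`. -/
noncomputable def growthConst : ℝ := Real.exp π * (1 + π * Real.exp π)

theorem growthConst_pos : 0 < growthConst := by
  unfold growthConst
  have := Real.pi_pos
  positivity

/-- Two exponents are allowed because `b = a` gives `duhamel`, while `b = 2 (a - i m)` gives the
slowly varying factor in the integration by parts below. -/
theorem norm_exp_mul_add_integral_le {a b c : ℂ} (ha : |a.re| ≤ 1) (hb : |b.re| ≤ 1) (k : L2I)
    {x : ℝ} (hx : x ∈ Icc 0 π) :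
    ‖Complex.exp (b * x) * (c + ∫ t in 0..x, Complex.exp (-a * t) * k t)‖ ≤
      growthConst * (‖c‖ + ‖k‖) := by
  have h1 := norm_integral_exp_mul_le (a := -a) (by simpa using ha) k hx
  rw [norm_mul, growthConst, mul_assoc]
  refine mul_le_mul (norm_exp_mul_le hb hx) ((norm_add_le _ _).trans ?_) (norm_nonneg _)
    (Real.exp_pos _).le
  have : 0 ≤ π * Real.exp π * ‖c‖ := by have := Real.pi_pos; positivity
  nlinarith [norm_nonneg k]

theorem norm_duhamel_le {a c : ℂ} (ha : |a.re| ≤ 1) (k : L2I) {x : ℝ} (hx : x ∈ Icc 0 π) :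
    ‖duhamel a c k x‖ ≤ growthConst * (‖c‖ + ‖k‖) :=
  norm_exp_mul_add_integral_le ha ha k hx

/-! ### Oscillatory integrals -/

/-- The oscillatory integral `∫₀ˣ e^{2imt} P(t) dt`. -/
noncomputable def osc (m : ℤ) (P : L2I) (x : ℝ) : ℂ :=
  ∫ t in 0..x, Complex.exp (2 * Complex.I * m * t) * P t

theorem hasACDeriv_osc (m : ℤ) (P : L2I) :
    HasACDeriv (osc m P) (fun t => Complex.exp (2 * Complex.I * m * t) * P t) := by
  have h := hasACDeriv_integral
    (intervalIntegrable_exp_mul (2 * Complex.I * m) P.intervalIntegrable) 0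
  simp only [zero_add] at h
  exact h

theorem continuousOn_osc (m : ℤ) (P : L2I) : ContinuousOn (osc m P) (Icc 0 π) :=
  (hasACDeriv_osc m P).continuousOn

/-- The `L²` norm of the oscillatory integral. -/
noncomputable def oscNorm (m : ℤ) (P : L2I) : ℝ := √(∫ t, ‖osc m P t‖ ^ 2 ∂μI)

theorem integral_norm_osc_mul_le (m : ℤ) (P k : L2I) :
    ∫ t, ‖osc m P t‖ * ‖k t‖ ∂μI ≤ oscNorm m P * ‖k‖ :=
  integral_norm_mul_le (Filter.Eventually.of_forall fun _ => norm_nonneg _)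
    (memLp_of_continuousOn (continuousOn_osc m P).norm) k

theorem integral_norm_osc_le (m : ℤ) (P : L2I) : ∫ t, ‖osc m P t‖ ∂μI ≤ oscNorm m P := by
  have h := integral_mul_le_sqrt (f := fun t => ‖osc m P t‖) (g := fun _ => 1)
    (Filter.Eventually.of_forall fun _ => norm_nonneg _)
    (Filter.Eventually.of_forall fun _ => zero_le_one)
    (memLp_of_continuousOn (continuousOn_osc m P).norm) (memLp_const 1)
  simpa [oscNorm] using h

/-- Integration by parts. The factor `e^{2at}` splits as `e^{2imt} e^{2(a - im)t}`; the fast part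
joins `P` and is integrated to `osc m P`, which vanishes at `0`, and the slow part is
differentiated. -/
theorem integral_exp_mul_duhamel_eq (a c : ℂ) (m : ℤ) (P k : L2I) {x : ℝ} (hx : x ∈ Icc 0 π) :
    ∫ t in 0..x, Complex.exp (a * t) * (P t * duhamel a c k t) =
      osc m P x * (Complex.exp (2 * (a - Complex.I * m) * x) *
        (c + ∫ t in 0..x, Complex.exp (-a * t) * k t)) -
      ∫ t in 0..x, osc m P t * (Complex.exp (2 * (a - Complex.I * m) * t) *
        (2 * (a - Complex.I * m)) * (c + ∫ s in 0..t, Complex.exp (-a * s) * k s) +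
        Complex.exp (2 * (a - Complex.I * m) * t) * (Complex.exp (-a * t) * k t)) := by
  have hΨ := (hasACDeriv_exp (2 * (a - Complex.I * m))).mul
    (hasACDeriv_integral (intervalIntegrable_exp_mul (-a) k.intervalIntegrable) c)
  have hH := hasACDeriv_osc m P
  have h := (hH.mul hΨ).eq_integral hx
  have i1 := IntervalIntegrable.mono_zero_pi
    (hH.integrable.mul_continuousOn hΨ.absCont.continuousOn) hx
  have i2 := IntervalIntegrable.mono_zero_pi
    (hΨ.integrable.continuousOn_mul hH.absCont.continuousOn) hx
  rw [intervalIntegral.integral_add i1 i2] at h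
  have h0 : osc m P 0 = 0 := by simp [osc]
  rw [h0, zero_mul, zero_add] at h
  rw [eq_sub_iff_add_eq, h]
  congr 1
  refine intervalIntegral.integral_congr fun t _ => ?_
  have e : Complex.exp (2 * Complex.I * m * t) * Complex.exp (2 * (a - Complex.I * m) * t) =
      Complex.exp (a * t) * Complex.exp (a * t) := by
    rw [← Complex.exp_add, ← Complex.exp_add]
    congr 1
    ring
  simp only [duhamel]
  linear_combination -(P t * (c + ∫ s in 0..t, Complex.exp (-a * s) * k s)) * e

/-- A constant for the second order oscillation estimate. -/
noncomputable def oscConst : ℝ := growthConst + π * (growthConst + Real.exp π * Real.exp π)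

theorem oscConst_pos : 0 < oscConst := by
  have := growthConst_pos
  have := Real.pi_pos
  unfold oscConst
  positivity

theorem abs_re_le_of_norm_sub_le {a : ℂ} {m : ℤ} (ha : ‖a - Complex.I * m‖ ≤ 1 / 2) :
    |a.re| ≤ 1 := by
  have := (Complex.abs_re_le_norm (a - Complex.I * m)).trans ha
  simp at this
  linarith

/-- The boundary term gives `‖osc m P x‖`; Cauchy–Schwarz on the remaining integral gives `oscNorm m
P`. The potential `P` enters only through its oscillatory integrals, and the constant does not
depend on `m`. -/
theorem norm_integral_exp_mul_duhamel_le {a c : ℂ} {m : ℤ} (ha : ‖a - Complex.I * m‖ ≤ 1 / 2)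
    (P k : L2I) {x : ℝ} (hx : x ∈ Icc 0 π) :
    ‖∫ t in 0..x, Complex.exp (a * t) * (P t * duhamel a c k t)‖ ≤
      oscConst * (‖c‖ + ‖k‖) * (‖osc m P x‖ + oscNorm m P) := by
  have hre := abs_re_le_of_norm_sub_le ha
  have hζ : ‖2 * (a - Complex.I * m)‖ ≤ 1 := by
    rw [norm_mul, Complex.norm_ofNat]; linarith
  have hζre : |(2 * (a - Complex.I * m)).re| ≤ 1 := (Complex.abs_re_le_norm _).trans hζ
  have hos := memLp_of_continuousOn (continuousOn_osc m P).norm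
  have hmul : Integrable (fun t => ‖osc m P t‖ * ‖k t‖) μI :=
    hos.integrable_mul (Lp.memLp k).norm
  have hG : Integrable (fun t => growthConst * (‖c‖ + ‖k‖) * ‖osc m P t‖ +
      Real.exp π * Real.exp π * (‖osc m P t‖ * ‖k t‖)) μI :=
    ((hos.integrable one_le_two).const_mul _).add
      (hmul.const_mul _)
  rw [integral_exp_mul_duhamel_eq a c m P k hx]
  have h1 := norm_exp_mul_add_integral_le (c := c) hre hζre k hx
  have h2 := norm_intervalIntegral_le hG (g := fun t => osc m P t *
      (Complex.exp (2 * (a - Complex.I * m) * t) *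
        (2 * (a - Complex.I * m)) * (c + ∫ s in 0..t, Complex.exp (-a * s) * k s) +
        Complex.exp (2 * (a - Complex.I * m) * t) * (Complex.exp (-a * t) * k t))) (by
    filter_upwards [ae_mem_Icc_μI] with t ht
    rw [norm_mul]
    have e1 := norm_exp_mul_add_integral_le (c := c) hre hζre k ht
    have e2 : ‖Complex.exp (2 * (a - Complex.I * m) * t) * (Complex.exp (-a * t) * k t)‖ ≤
        Real.exp π * Real.exp π * ‖k t‖ := by
      rw [← mul_assoc, norm_mul, norm_mul]
      gcongr
      · exact norm_exp_mul_le hζre ht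
      · exact norm_exp_mul_le (by simpa using hre) ht
    have e3 : ‖Complex.exp (2 * (a - Complex.I * m) * t) * (2 * (a - Complex.I * m)) *
        (c + ∫ s in 0..t, Complex.exp (-a * s) * k s)‖ ≤ growthConst * (‖c‖ + ‖k‖) := by
      rw [mul_right_comm, norm_mul]
      exact (mul_le_of_le_one_right (norm_nonneg _) hζ).trans e1
    calc _ ≤ ‖osc m P t‖ * (growthConst * (‖c‖ + ‖k‖) + Real.exp π * Real.exp π * ‖k t‖) := by
          gcongr
          exact (norm_add_le _ _).trans (add_le_add e3 e2)
      _ = _ := by ring) hx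
  rw [integral_add ((hos.integrable one_le_two).const_mul _)
    (hmul.const_mul _), integral_const_mul,
    integral_const_mul] at h2
  have g0 := growthConst_pos
  have p0 := Real.pi_pos
  have o0 : 0 ≤ oscNorm m P := Real.sqrt_nonneg _
  have h3 : ‖∫ t in 0..x, osc m P t *
      (Complex.exp (2 * (a - Complex.I * m) * t) *
        (2 * (a - Complex.I * m)) * (c + ∫ s in 0..t, Complex.exp (-a * s) * k s) +
        Complex.exp (2 * (a - Complex.I * m) * t) * (Complex.exp (-a * t) * k t))‖ ≤
      π * (growthConst + Real.exp π * Real.exp π) * (‖c‖ + ‖k‖) * oscNorm m P := by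
    refine h2.trans ?_
    calc _ ≤ π * (growthConst * (‖c‖ + ‖k‖) * oscNorm m P +
          Real.exp π * Real.exp π * (oscNorm m P * (‖c‖ + ‖k‖))) := by
          gcongr
          · exact integral_norm_osc_le m P
          · refine (integral_norm_osc_mul_le m P k).trans ?_
            gcongr
            linarith [norm_nonneg c]
      _ = _ := by ring
  refine (norm_sub_le _ _).trans ((add_le_add ((norm_mul_le _ _).trans
    (mul_le_mul_of_nonneg_left h1 (norm_nonneg _))) h3).trans ?_)
  -- `q1` and `q2` are the cross terms by which the product with `oscConst` exceeds the two terms at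
  -- hand.
  have q1 : 0 ≤ (‖c‖ + ‖k‖) * (π * (growthConst + Real.exp π * Real.exp π)) * ‖osc m P x‖ := by
    positivity
  have q2 : 0 ≤ (‖c‖ + ‖k‖) * growthConst * oscNorm m P := by positivity
  unfold oscConst
  linarith

/-! ### Bessel's inequality for oscillatory integrals -/

theorem continuous_expFun (n : ℤ) :
    Continuous (fun t : ℝ => Complex.exp (-(2 * Complex.I * n * t))) := by fun_prop

/-- The exponential `e^{-2int}` as an element of `L²`. -/
noncomputable def expL2 (n : ℤ) : L2I :=
  (memLp_of_continuousOn (continuous_expFun n).continuousOn).toLp _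

theorem coeFn_expL2 (n : ℤ) :
    ∀ᵐ t ∂μI, expL2 n t = Complex.exp (-(2 * Complex.I * n * t)) :=
  (memLp_of_continuousOn (continuous_expFun n).continuousOn).coeFn_toLp

theorem conj_exp_neg (n : ℤ) (t : ℝ) :
    (starRingEnd ℂ) (Complex.exp (-(2 * Complex.I * n * t))) =
      Complex.exp (2 * Complex.I * n * t) := by
  rw [← Complex.exp_conj]
  simp [Complex.conj_ofNat]

/-- The inner product is conjugate linear on the left, so the minus sign in `expL2` produces the
kernel `e^{2int}` of `osc`. -/
theorem inner_expL2 (n : ℤ) (f : L2I) :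
    inner ℂ (expL2 n) f = ∫ t, Complex.exp (2 * Complex.I * n * t) * f t ∂μI := by
  rw [L2.inner_def]
  refine integral_congr_ae ?_
  filter_upwards [coeFn_expL2 n] with t ht
  rw [RCLike.inner_apply, ht, conj_exp_neg, mul_comm]

theorem orthonormal_expL2 : Orthonormal ℂ expL2 := by
  rw [orthonormal_iff_ite]
  intro m n
  rw [inner_expL2]
  have h1 : ∫ t, Complex.exp (2 * Complex.I * m * t) * expL2 n t ∂μI =
      ∫ t : ℝ, Complex.exp (2 * Complex.I * ((m - n : ℤ) : ℂ) * t) ∂μI := by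
    refine integral_congr_ae ?_
    filter_upwards [coeFn_expL2 n] with t ht
    rw [ht, ← Complex.exp_add]
    congr 1
    push_cast
    ring
  rw [h1]
  split_ifs with hmn
  · simp [hmn]
  · have h2 := intervalIntegral_eq_integral_μI
      (fun t : ℝ => Complex.exp (2 * Complex.I * ((m - n : ℤ) : ℂ) * t))
    have hne : (2 * Complex.I * ((m - n : ℤ) : ℂ)) ≠ 0 := by
      simp [Complex.I_ne_zero, sub_eq_zero, hmn]
    rw [integral_exp_mul_complex hne] at h2
    have h3 : Complex.exp (2 * Complex.I * ((m - n : ℤ) : ℂ) * π) = 1 :=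
      Complex.exp_eq_one_iff.2 ⟨m - n, by ring⟩
    rw [h3] at h2
    simpa [Real.pi_ne_zero] using h2.symm

/-- Bessel's inequality for `P` cut off at `x`, whose coefficients times `π` are the `osc n P x`.
The cutoff does not increase the norm, so the bound is uniform in `x`. -/
theorem sum_norm_osc_sq_le (s : Finset ℤ) (P : L2I) {x : ℝ} (hx : x ∈ Icc 0 π) :
    ∑ n ∈ s, ‖osc n P x‖ ^ 2 ≤ π ^ 2 * ‖P‖ ^ 2 := by
  have hm : MemLp ((Iic x).indicator P) 2 μI := (Lp.memLp P).indicator measurableSet_Iic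
  have hosc : ∀ n, osc n P x = π • inner ℂ (expL2 n) (hm.toLp _) := fun n => by
    rw [inner_expL2, ← intervalIntegral_eq_integral_μI]
    have h1 : ∫ t in 0..π, Complex.exp (2 * Complex.I * n * t) * hm.toLp _ t =
        ∫ t in 0..π, (Iic x).indicator (fun t : ℝ => Complex.exp (2 * Complex.I * n * t) * P t) t := by
      rw [intervalIntegral_eq_integral_μI, intervalIntegral_eq_integral_μI]
      congr 1
      refine integral_congr_ae ?_
      filter_upwards [hm.coeFn_toLp] with t ht
      rw [ht]
      by_cases h : t ∈ Iic x <;> simp [h]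
    rw [h1, intervalIntegral.integral_of_le Real.pi_pos.le,
      integral_indicator measurableSet_Iic, Measure.restrict_restrict measurableSet_Iic,
      osc, intervalIntegral.integral_of_le hx.1]
    congr 2
    ext t
    simp only [mem_Ioc, mem_inter_iff, mem_Iic]
    have := hx.2
    constructor
    · rintro ⟨h1, h2⟩; exact ⟨h2, h1, h2.trans this⟩
    · rintro ⟨h2, h1, -⟩; exact ⟨h1, h2⟩
  have hle : ‖hm.toLp _‖ ≤ ‖P‖ := by
    refine Lp.norm_le_norm_of_ae_le ?_
    filter_upwards [hm.coeFn_toLp] with t ht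
    rw [ht]
    exact norm_indicator_le_norm_self _ _
  calc ∑ n ∈ s, ‖osc n P x‖ ^ 2 = π ^ 2 * ∑ n ∈ s, ‖inner ℂ (expL2 n) (hm.toLp _)‖ ^ 2 := by
        rw [Finset.mul_sum]
        refine Finset.sum_congr rfl fun n _ => ?_
        rw [hosc, norm_smul, mul_pow, Real.norm_of_nonneg Real.pi_pos.le]
    _ ≤ π ^ 2 * ‖hm.toLp _‖ ^ 2 := by
        gcongr
        exact orthonormal_expL2.sum_inner_products_le _
    _ ≤ _ := by gcongr

theorem integrable_mul_continuousOn {w U : ℝ → ℝ} (hw : Integrable w μI)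
    (hU : ContinuousOn U (Icc 0 π)) : Integrable (fun t => w t * U t) μI := by
  obtain ⟨C, hC⟩ := isCompact_Icc.exists_bound_of_continuousOn hU
  exact hw.mul_bdd (c := C) (aestronglyMeasurable_of_continuousOn hU)
    (ae_mem_Icc_μI.mono fun x hx => hC x hx)

/-- A bound of the sum at every point can be integrated against a weight that is merely in `L¹`, as
is needed for `‖P‖²` with `P` in `L²`. -/
theorem sum_integral_mul_le {ι : Type*} {U : ι → ℝ → ℝ} {w : ℝ → ℝ} {K : ℝ}
    (hw : Integrable w μI) (hw0 : ∀ t, 0 ≤ w t) (hU : ∀ n, ContinuousOn (U n) (Icc 0 π))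
    (s : Finset ι) (hK : ∀ x ∈ Icc 0 π, ∑ n ∈ s, U n x ≤ K) :
    ∑ n ∈ s, ∫ t, w t * U n t ∂μI ≤ K * ∫ t, w t ∂μI := by
  rw [← integral_finsetSum _ fun n _ => integrable_mul_continuousOn hw (hU n),
    ← integral_const_mul]
  refine integral_mono_ae (integrable_finsetSum _ fun n _ =>
    integrable_mul_continuousOn hw (hU n)) (hw.const_mul _) ?_
  filter_upwards [ae_mem_Icc_μI] with t ht
  rw [← Finset.mul_sum, mul_comm K]
  exact mul_le_mul_of_nonneg_left (hK t ht) (hw0 t)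

theorem oscNorm_sq (m : ℤ) (P : L2I) : oscNorm m P ^ 2 = ∫ t, ‖osc m P t‖ ^ 2 ∂μI :=
  Real.sq_sqrt (integral_nonneg fun _ => by positivity)

theorem sum_oscNorm_sq_le (s : Finset ℤ) (P : L2I) :
    ∑ n ∈ s, oscNorm n P ^ 2 ≤ π ^ 2 * ‖P‖ ^ 2 := by
  have h := sum_integral_mul_le (w := fun _ => 1) (U := fun n t => ‖osc n P t‖ ^ 2)
    (integrable_const 1) (fun _ => zero_le_one) (fun n => (continuousOn_osc n P).norm.pow 2) s
    (fun x hx => sum_norm_osc_sq_le s P hx)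
  simpa [oscNorm_sq] using h

/-- A pointwise measure of the size of the oscillatory integrals. -/
noncomputable def oscSq (m : ℤ) (P : L2I) (x : ℝ) : ℝ :=
  -- The value at `x` comes from the forcing integral up to `x`, the value at `π` from the initial
  -- values fixed by the boundary condition, and the norm from the remainder of the integration by
  -- parts.
  ‖osc m P x‖ ^ 2 + ‖osc m P π‖ ^ 2 + oscNorm m P ^ 2

theorem oscSq_nonneg (m : ℤ) (P : L2I) (x : ℝ) : 0 ≤ oscSq m P x := by
  unfold oscSq
  positivity

theorem continuousOn_oscSq (m : ℤ) (P : L2I) : ContinuousOn (oscSq m P) (Icc 0 π) :=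
  (((continuousOn_osc m P).norm.pow 2).add continuousOn_const).add continuousOn_const

theorem sum_oscSq_le (s : Finset ℤ) (P : L2I) {x : ℝ} (hx : x ∈ Icc 0 π) :
    ∑ n ∈ s, oscSq n P x ≤ 3 * (π ^ 2 * ‖P‖ ^ 2) := by
  simp only [oscSq, Finset.sum_add_distrib]
  linarith [sum_norm_osc_sq_le s P hx, sum_norm_osc_sq_le s P pi_mem_Icc_pi,
    sum_oscNorm_sq_le s P]

theorem sum_oscSq_neg_le (s : Finset ℤ) (P : L2I) {x : ℝ} (hx : x ∈ Icc 0 π) :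
    ∑ n ∈ s, oscSq (-n) P x ≤ 3 * (π ^ 2 * ‖P‖ ^ 2) := by
  have h := sum_oscSq_le (s.map (Equiv.neg ℤ).toEmbedding) P hx
  rwa [Finset.sum_map] at h

/-- The weight against which the oscillatory integrals are measured. -/
noncomputable def weight (P Q : L2I) (t : ℝ) : ℝ := 1 + ‖P t‖ ^ 2 + ‖Q t‖ ^ 2

theorem weight_nonneg (P Q : L2I) (t : ℝ) : 0 ≤ weight P Q t := by
  unfold weight
  positivity

theorem integrable_weight (P Q : L2I) : Integrable (weight P Q) μI :=
  ((integrable_const 1).add (integrable_norm_sq P)).add (integrable_norm_sq Q)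

/-- The weighted energy of the oscillatory integrals of order `n`. -/
noncomputable def oscEnergy (P Q : L2I) (n : ℤ) : ℝ :=
  ∫ t, weight P Q t * (oscSq n P t + oscSq (-n) Q t) ∂μI

theorem integrable_weight_mul_oscSq (P Q : L2I) (n : ℤ) :
    Integrable (fun t => weight P Q t * (oscSq n P t + oscSq (-n) Q t)) μI :=
  integrable_mul_continuousOn (integrable_weight P Q)
    ((continuousOn_oscSq n P).add (continuousOn_oscSq (-n) Q))

theorem oscEnergy_nonneg (P Q : L2I) (n : ℤ) : 0 ≤ oscEnergy P Q n :=
  integral_nonneg fun t => mul_nonneg (weight_nonneg P Q t)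
    (add_nonneg (oscSq_nonneg _ _ _) (oscSq_nonneg _ _ _))

theorem summable_oscEnergy (P Q : L2I) : Summable (oscEnergy P Q) := by
  refine summable_of_sum_le (oscEnergy_nonneg P Q) fun s =>
    sum_integral_mul_le (K := 3 * (π ^ 2 * ‖P‖ ^ 2) + 3 * (π ^ 2 * ‖Q‖ ^ 2))
      (integrable_weight P Q) (weight_nonneg P Q)
      (fun n => (continuousOn_oscSq n P).add (continuousOn_oscSq (-n) Q)) s fun x hx => ?_
  simp only [Pi.add_apply]
  rw [Finset.sum_add_distrib]
  exact add_le_add (sum_oscSq_le s P hx) (sum_oscSq_neg_le s Q hx)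

/-! ### Boundary conditions -/

/-- The square is `e^{2πiz}`, of period `1`, so all circles reduce to the one around `0`. That
circle is compact and contains no integer, that is, no zero of `e^{2πiz} - 1`. -/
theorem exists_pos_le_norm_exp_sq_sub_one :
    ∃ δ > 0, ∀ (n : ℤ), ∀ z ∈ Metric.sphere (n : ℂ) (1 / 2),
      δ ≤ ‖Complex.exp (Complex.I * z * π) ^ 2 - 1‖ := by
  have hcont : Continuous fun z : ℂ => ‖Complex.exp (2 * π * Complex.I * z) - 1‖ := by fun_prop
  have hpos : ∀ z ∈ Metric.sphere (0 : ℂ) (1 / 2),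
      0 < ‖Complex.exp (2 * π * Complex.I * z) - 1‖ := by
    intro z hz
    rw [norm_pos_iff, sub_ne_zero]
    intro h
    obtain ⟨k, hk⟩ := Complex.exp_eq_one_iff.1 h
    have hzk : z = k := by
      rw [mul_comm (k : ℂ)] at hk
      exact mul_left_cancel₀ Complex.two_pi_I_ne_zero hk
    rw [mem_sphere_zero_iff_norm, hzk, Complex.norm_intCast] at hz
    have h2 : |2 * k| = 1 := by
      have : |(2 * k : ℝ)| = 1 := by rw [abs_mul, hz]; norm_num
      exact_mod_cast this
    rcases (abs_eq zero_le_one).1 h2 with h3 | h3 <;> omega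
  obtain ⟨δ, hδ, h⟩ := (isCompact_sphere (0 : ℂ) (1 / 2)).exists_forall_le' hcont.continuousOn hpos
  refine ⟨δ, hδ, fun n z hz => ?_⟩
  have h1 := h (z - n) (by
    rw [mem_sphere_zero_iff_norm]
    rwa [mem_sphere_iff_norm] at hz)
  have h2 : Complex.exp (Complex.I * z * π) ^ 2 = Complex.exp (2 * π * Complex.I * (z - n)) := by
    rw [← Complex.exp_nat_mul, Complex.exp_eq_exp_iff_exists_int]
    exact ⟨n, by push_cast; ring⟩
  rw [h2]
  exact h1

/-- The linear system for the initial values given by the boundary condition, where `w` is the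
free propagator over `[0, π]`, is solvable. -/
theorem BC.exists_solution (bc : BC) {w : ℂ} (hw : w ^ 2 - 1 ≠ 0) (hw0 : w ≠ 0) (a₁ a₂ : ℂ) :
    ∃ c₁ c₂ : ℂ, ∀ F₁ F₂ : ℝ → ℂ, F₁ 0 = c₁ → F₂ 0 = c₂ → F₁ π = w⁻¹ * (c₁ + a₁) →
      F₂ π = w * (c₂ + a₂) → bc.Holds F₁ F₂ := by
  cases bc
  -- The periodic and antiperiodic systems decouple, with determinants `w - 1` and `w + 1` up to
  -- units; the fractions are expanded so that `w² - 1`, the Dirichlet determinant, is the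
  -- denominator in all cases.
  · refine ⟨a₁ * (w + 1) / (w ^ 2 - 1), -(w * a₂ * (w + 1)) / (w ^ 2 - 1), ?_⟩
    rintro F₁ F₂ h1 h2 h3 h4
    simp only [BC.Holds, h1, h2, h3, h4]
    constructor <;> field_simp <;> ring
  · refine ⟨-(a₁ * (w - 1)) / (w ^ 2 - 1), -(w * a₂ * (w - 1)) / (w ^ 2 - 1), ?_⟩
    rintro F₁ F₂ h1 h2 h3 h4
    simp only [BC.Holds, h1, h2, h3, h4]
    constructor <;> field_simp <;> ring
  · refine ⟨(a₁ - w ^ 2 * a₂) / (w ^ 2 - 1), (a₁ - w ^ 2 * a₂) / (w ^ 2 - 1), ?_⟩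
    rintro F₁ F₂ h1 h2 h3 h4
    simp only [BC.Holds, h1, h2, h3, h4]
    refine ⟨trivial, ?_⟩
    field_simp
    ring

/-- In each case Cramer's rule gives `c (w² - 1) = p a₁ + q a₂`, with `p` and `q` polynomials in `w`
of modulus at most `(1 + M)²`. -/
theorem BC.norm_le (bc : BC) {w : ℂ} {M δ : ℝ} (hδ : 0 < δ) (hw : δ ≤ ‖w ^ 2 - 1‖) (hM : ‖w‖ ≤ M)
    (hw0 : w ≠ 0) {a₁ a₂ : ℂ} {F₁ F₂ : ℝ → ℂ} (h₁ : F₁ π = w⁻¹ * (F₁ 0 + a₁))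
    (h₂ : F₂ π = w * (F₂ 0 + a₂)) (h : bc.Holds F₁ F₂) :
    ‖F₁ 0‖ ≤ (1 + M) ^ 2 / δ * (‖a₁‖ + ‖a₂‖) ∧ ‖F₂ 0‖ ≤ (1 + M) ^ 2 / δ * (‖a₁‖ + ‖a₂‖) := by
  have hM0 : 0 ≤ M := (norm_nonneg w).trans hM
  have h₁' : w * F₁ π = F₁ 0 + a₁ := by rw [h₁, mul_inv_cancel_left₀ hw0]
  have fin : ∀ c p q : ℂ, c * (w ^ 2 - 1) = p * a₁ + q * a₂ → ‖p‖ ≤ (1 + M) ^ 2 →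
      ‖q‖ ≤ (1 + M) ^ 2 → ‖c‖ ≤ (1 + M) ^ 2 / δ * (‖a₁‖ + ‖a₂‖) := by
    intro c p q hc hp hq
    rw [div_mul_eq_mul_div, le_div_iff₀ hδ]
    calc ‖c‖ * δ ≤ ‖c * (w ^ 2 - 1)‖ := by rw [norm_mul]; gcongr
      _ ≤ ‖p‖ * ‖a₁‖ + ‖q‖ * ‖a₂‖ := by
        rw [hc, ← norm_mul, ← norm_mul]; exact norm_add_le _ _
      _ ≤ (1 + M) ^ 2 * ‖a₁‖ + (1 + M) ^ 2 * ‖a₂‖ := by gcongr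
      _ = _ := by ring
  have n0 : ‖(0 : ℂ)‖ ≤ (1 + M) ^ 2 := by rw [norm_zero]; positivity
  have n1 : ‖(1 : ℂ)‖ ≤ (1 + M) ^ 2 := by rw [norm_one]; nlinarith
  have np : ‖w + 1‖ ≤ 1 + M := (norm_add_le _ _).trans (by rw [norm_one]; linarith)
  have nm : ‖w - 1‖ ≤ 1 + M := (norm_sub_le _ _).trans (by rw [norm_one]; linarith)
  have np' : ‖w + 1‖ ≤ (1 + M) ^ 2 := np.trans (by nlinarith)
  have nm' : ‖-(w - 1)‖ ≤ (1 + M) ^ 2 := by rw [norm_neg]; exact nm.trans (by nlinarith)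
  have nwp : ‖-(w * (w + 1))‖ ≤ (1 + M) ^ 2 := by
    rw [norm_neg, norm_mul, sq]
    exact mul_le_mul (by linarith) np (norm_nonneg _) (by linarith)
  have nwm : ‖-(w * (w - 1))‖ ≤ (1 + M) ^ 2 := by
    rw [norm_neg, norm_mul, sq]
    exact mul_le_mul (by linarith) nm (norm_nonneg _) (by linarith)
  have nww : ‖-w ^ 2‖ ≤ (1 + M) ^ 2 := by
    rw [norm_neg, norm_pow]
    exact pow_le_pow_left₀ (norm_nonneg _) (by linarith) 2
  cases bc
  · obtain ⟨e1, e2⟩ := h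
    rw [← e1] at h₁'
    rw [← e2] at h₂
    exact ⟨fin _ (w + 1) 0 (by linear_combination (w + 1) * h₁') np' n0,
      fin _ 0 (-(w * (w + 1))) (by linear_combination -(w + 1) * h₂) n0 nwp⟩
  · obtain ⟨e1, e2⟩ := h
    have e1' : F₁ π = -F₁ 0 := by rw [e1, neg_neg]
    have e2' : F₂ π = -F₂ 0 := by rw [e2, neg_neg]
    rw [e1'] at h₁'
    rw [e2'] at h₂
    exact ⟨fin _ (-(w - 1)) 0 (by linear_combination -(w - 1) * h₁') nm' n0,
      fin _ 0 (-(w * (w - 1))) (by linear_combination -(w - 1) * h₂) n0 nwm⟩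
  · obtain ⟨e1, e2⟩ := h
    rw [e2, h₂, ← e1] at h₁'
    have := fin (F₁ 0) 1 (-w ^ 2) (by linear_combination h₁') n1 nww
    exact ⟨this, e1 ▸ this⟩

/-! ### The free resolvent equation -/

theorem mulBy_zero (f : W12) : mulBy 0 f = 0 := by
  refine Lp.ext ?_
  filter_upwards [(memLp_mul 0 f).coeFn_toLp, Lp.coeFn_zero ℂ 2 μI] with x h1 h2
  change (memLp_mul 0 f).toLp _ x = _
  rw [h1, h2, Pi.zero_apply, zero_mul]

/-- The perturbation `y ↦ v y` on the domain of the Dirac operator. -/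
noncomputable def potential (bc : BC) (P Q : L2I) : diracDomain bc →ₗ[ℂ] H0 where
  toFun y := WithLp.toLp 2 (mulBy P (compSnd bc y), mulBy Q (compFst bc y))
  map_add' y y' := by
    rw [← WithLp.toLp_add, Prod.mk_add_mk]
    simp only [map_add]
  map_smul' c y := by
    rw [RingHom.id_apply, ← WithLp.toLp_smul, Prod.smul_mk]
    simp only [map_smul]

theorem dirac_apply_eq (bc : BC) (P Q : L2I) (y : diracDomain bc) :
    (dirac bc P Q).toFun y = (freeDirac bc).toFun y + potential bc P Q y := by
  change WithLp.toLp 2 (_, _) = WithLp.toLp 2 (_, _) + WithLp.toLp 2 (_, _)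
  rw [← WithLp.toLp_add, Prod.mk_add_mk, mulBy_zero, mulBy_zero, add_zero, add_zero]

theorem potential_fst_ae (bc : BC) (P Q : L2I) (y : diracDomain bc) :
    ∀ᵐ t ∂μI, (potential bc P Q y).fst t = P t * (y : H0).snd t :=
  (memLp_mul P (compSnd bc y)).coeFn_toLp

theorem potential_snd_ae (bc : BC) (P Q : L2I) (y : diracDomain bc) :
    ∀ᵐ t ∂μI, (potential bc P Q y).snd t = Q t * (y : H0).fst t :=
  (memLp_mul Q (compFst bc y)).coeFn_toLp

theorem norm_fst_le (f : H0) : ‖f.fst‖ ≤ ‖f‖ := by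
  have := WithLp.prod_norm_sq_eq_of_L2 f
  exact abs_le_of_sq_le_sq' (by nlinarith [sq_nonneg ‖f.snd‖]) (norm_nonneg _) |>.2

theorem norm_snd_le (f : H0) : ‖f.snd‖ ≤ ‖f‖ := by
  have := WithLp.prod_norm_sq_eq_of_L2 f
  exact abs_le_of_sq_le_sq' (by nlinarith [sq_nonneg ‖f.fst‖]) (norm_nonneg _) |>.2

theorem norm_le_of_components {f : H0} {C : ℝ} (h1 : ‖f.fst‖ ≤ C) (h2 : ‖f.snd‖ ≤ C) :
    ‖f‖ ≤ 2 * C := by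
  have := WithLp.prod_norm_sq_eq_of_L2 f
  have h0 := (norm_nonneg _).trans h1
  refine abs_le_of_sq_le_sq' ?_ (by linarith) |>.2
  nlinarith [norm_nonneg f.fst, norm_nonneg f.snd]

theorem norm_I_mul_sub_le {n : ℤ} {z : ℂ} (hz : z ∈ Metric.sphere (n : ℂ) (1 / 2)) :
    ‖Complex.I * z - Complex.I * n‖ ≤ 1 / 2 := by
  rw [← mul_sub, norm_mul, Complex.norm_I, one_mul]
  rw [mem_sphere_iff_norm] at hz
  exact hz.le

theorem norm_neg_I_mul_sub_le {n : ℤ} {z : ℂ} (hz : z ∈ Metric.sphere (n : ℂ) (1 / 2)) :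
    ‖-(Complex.I * z) - Complex.I * (-n : ℤ)‖ ≤ 1 / 2 := by
  have : -(Complex.I * z) - Complex.I * (-n : ℤ) = -(Complex.I * z - Complex.I * n) := by
    push_cast; ring
  rw [this, norm_neg]
  exact norm_I_mul_sub_le hz

/-- `y` solves the free resolvent equation with right hand side `f`, with initial values `c₁`,
`c₂` controlled by the constant `C`. -/
structure IsFreeSolution (z : ℂ) (C : ℝ) (f y : H0) (c₁ c₂ : ℂ) : Prop where
  fst_ae : ∀ᵐ t ∂μI, y.fst t = duhamel (-(Complex.I * z)) c₁ (Complex.I • f.fst : L2I) t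
  snd_ae : ∀ᵐ t ∂μI, y.snd t = duhamel (Complex.I * z) c₂ (-Complex.I • f.snd : L2I) t
  norm_left : ‖c₁‖ ≤ C *
    (‖∫ t in 0..π, Complex.exp (Complex.I * z * t) * (Complex.I • f.fst : L2I) t‖ +
      ‖∫ t in 0..π, Complex.exp (-(Complex.I * z) * t) * (-Complex.I • f.snd : L2I) t‖)
  norm_right : ‖c₂‖ ≤ C *
    (‖∫ t in 0..π, Complex.exp (Complex.I * z * t) * (Complex.I • f.fst : L2I) t‖ +
      ‖∫ t in 0..π, Complex.exp (-(Complex.I * z) * t) * (-Complex.I • f.snd : L2I) t‖)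

theorem freeDirac_fst (bc : BC) (y : diracDomain bc) :
    ((freeDirac bc).toFun y).fst = Complex.I • ddx (compFst bc y) := by
  change Complex.I • ddx (compFst bc y) + mulBy 0 _ = _
  rw [mulBy_zero, add_zero]

theorem freeDirac_snd (bc : BC) (y : diracDomain bc) :
    ((freeDirac bc).toFun y).snd = -Complex.I • ddx (compSnd bc y) := by
  change -Complex.I • ddx (compSnd bc y) + mulBy 0 _ = _
  rw [mulBy_zero, add_zero]

/-- The constant serves all `n` and `z` at once: with `w = e^{iπz}`, both `|w| ≤ e^π` and the lower
bound for `|w² - 1|` are uniform over the circles. -/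
theorem exists_isFreeSolution (bc : BC) :
    ∃ C : ℝ, 0 ≤ C ∧ ∀ (n : ℤ), ∀ z ∈ Metric.sphere (n : ℂ) (1 / 2), ∀ (y : diracDomain bc) (f : H0),
      z • (y : H0) - (freeDirac bc).toFun y = f → ∃ c₁ c₂, IsFreeSolution z C f y c₁ c₂ := by
  obtain ⟨δ, hδ, hδn⟩ := exists_pos_le_norm_exp_sq_sub_one
  refine ⟨(1 + Real.exp π) ^ 2 / δ, by positivity, fun n z hz y f hf => ?_⟩
  obtain ⟨F₁, F₂, g₁, g₂, h₁, h₂, hb⟩ := y.2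
  have hg₁ : g₁ = -(Complex.I * z) • (y : H0).fst + Complex.I • f.fst := by
    have e : f.fst = z • (y : H0).fst - Complex.I • g₁ := by
      rw [← hf, WithLp.sub_fst, WithLp.smul_fst, freeDirac_fst]
      rw [h₁.ddx_eq (f := (y : H0).fst) (compFst bc y).2 |>.symm]
      rfl
    rw [e, smul_sub, smul_smul, smul_smul, Complex.I_mul_I]
    module
  have hg₂ : g₂ = (Complex.I * z) • (y : H0).snd + (-Complex.I) • f.snd := by
    have e : f.snd = z • (y : H0).snd + Complex.I • g₂ := by
      rw [← hf, WithLp.sub_snd, WithLp.smul_snd, freeDirac_snd]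
      rw [h₂.ddx_eq (f := (y : H0).snd) (compSnd bc y).2 |>.symm, neg_smul, sub_neg_eq_add]
      rfl
    rw [e, smul_add, smul_smul, smul_smul, neg_mul, neg_mul, Complex.I_mul_I]
    module
  have e₁ : ∀ x ∈ Icc 0 π,
      F₁ x = duhamel (-(Complex.I * z)) (F₁ 0) (Complex.I • f.fst : L2I) x := fun x hx => by
    refine h₁.hasACDeriv.eq_duhamel ?_ hx
    filter_upwards [h₁.ae_eq, Lp.coeFn_add (-(Complex.I * z) • (y : H0).fst) (Complex.I • f.fst),
      Lp.coeFn_smul (-(Complex.I * z)) (y : H0).fst] with t q1 q2 q3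
    rw [hg₁, q2, Pi.add_apply, q3, Pi.smul_apply, q1, smul_eq_mul]
  have e₂ : ∀ x ∈ Icc 0 π,
      F₂ x = duhamel (Complex.I * z) (F₂ 0) (-Complex.I • f.snd : L2I) x := fun x hx => by
    refine h₂.hasACDeriv.eq_duhamel ?_ hx
    filter_upwards [h₂.ae_eq, Lp.coeFn_add ((Complex.I * z) • (y : H0).snd) (-Complex.I • f.snd),
      Lp.coeFn_smul (Complex.I * z) (y : H0).snd] with t q1 q2 q3
    rw [hg₂, q2, Pi.add_apply, q3, Pi.smul_apply, q1, smul_eq_mul]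
  have hM : ‖Complex.exp (Complex.I * z * π)‖ ≤ Real.exp π :=
    norm_exp_mul_le (abs_re_le_of_norm_sub_le (norm_I_mul_sub_le hz)) pi_mem_Icc_pi
  have p₁ := e₁ π pi_mem_Icc_pi
  have p₂ := e₂ π pi_mem_Icc_pi
  rw [duhamel, neg_mul, Complex.exp_neg, neg_neg] at p₁
  rw [duhamel] at p₂
  obtain ⟨b₁, b₂⟩ := bc.norm_le hδ (hδn n z hz) hM (Complex.exp_ne_zero _) p₁ p₂ hb
  refine ⟨F₁ 0, F₂ 0, ?_, ?_, b₁, b₂⟩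
  · filter_upwards [h₁.ae_eq, ae_mem_Icc_μI] with t q1 q2
    rw [q1, e₁ t q2]
  · filter_upwards [h₂.ae_eq, ae_mem_Icc_μI] with t q1 q2
    rw [q1, e₂ t q2]

theorem exists_solution_freeDirac (bc : BC) {n : ℤ} {z : ℂ}
    (hz : z ∈ Metric.sphere (n : ℂ) (1 / 2)) (f : H0) :
    ∃ y : diracDomain bc, z • (y : H0) - (freeDirac bc).toFun y = f := by
  obtain ⟨δ, hδ, hδn⟩ := exists_pos_le_norm_exp_sq_sub_one
  have hw : Complex.exp (Complex.I * z * π) ^ 2 - 1 ≠ 0 :=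
    norm_pos_iff.1 (hδ.trans_le (hδn n z hz))
  obtain ⟨c₁, c₂, hc⟩ := bc.exists_solution hw (Complex.exp_ne_zero _)
    (∫ t in 0..π, Complex.exp (Complex.I * z * t) * (Complex.I • f.fst : L2I) t)
    (∫ t in 0..π, Complex.exp (-(Complex.I * z) * t) * (-Complex.I • f.snd : L2I) t)
  obtain ⟨y₁, h₁⟩ := exists_isACRep_duhamel (-(Complex.I * z)) c₁ (Complex.I • f.fst)
  obtain ⟨y₂, h₂⟩ := exists_isACRep_duhamel (Complex.I * z) c₂ (-Complex.I • f.snd)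
  have hb := hc _ _ (duhamel_zero (-(Complex.I * z)) c₁ (Complex.I • f.fst : L2I))
    (duhamel_zero (Complex.I * z) c₂ (-Complex.I • f.snd : L2I))
    (by rw [duhamel, neg_mul, Complex.exp_neg, neg_neg]) rfl
  let y : diracDomain bc := ⟨WithLp.toLp 2 (y₁, y₂), _, _, _, _, h₁, h₂, hb⟩
  refine ⟨y, ?_⟩
  have d₁ : ddx (compFst bc y) = -(Complex.I * z) • y₁ + Complex.I • f.fst :=
    h₁.ddx_eq (compFst bc y).2
  have d₂ : ddx (compSnd bc y) = (Complex.I * z) • y₂ + -Complex.I • f.snd :=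
    h₂.ddx_eq (compSnd bc y).2
  have k₁ : (z • (y : H0) - (freeDirac bc).toFun y).fst = f.fst := by
    rw [WithLp.sub_fst, WithLp.smul_fst, freeDirac_fst, d₁, smul_add, smul_smul, smul_smul,
      Complex.I_mul_I, mul_neg, ← mul_assoc, Complex.I_mul_I]
    change z • y₁ - _ = _
    module
  have k₂ : (z • (y : H0) - (freeDirac bc).toFun y).snd = f.snd := by
    rw [WithLp.sub_snd, WithLp.smul_snd, freeDirac_snd, d₂, smul_add, smul_smul, smul_smul,
      neg_mul_neg, Complex.I_mul_I, neg_mul, ← mul_assoc, Complex.I_mul_I]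
    change z • y₂ - _ = _
    module
  exact (WithLp.ofLp_injective 2) (Prod.ext k₁ k₂)

/-! ### First order bounds for the free resolvent. -/

theorem norm_I_smul (f : L2I) : ‖Complex.I • f‖ = ‖f‖ := by simp [norm_smul]

theorem norm_neg_I_smul (f : L2I) : ‖-Complex.I • f‖ = ‖f‖ := by simp [norm_smul]

/-- A constant for the a priori bound of solutions in terms of the constant of
`IsFreeSolution`. -/
noncomputable def solConst (C : ℝ) : ℝ := C * (2 * (π * Real.exp π))

theorem solConst_nonneg {C : ℝ} (hC : 0 ≤ C) : 0 ≤ solConst C := by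
  have := Real.pi_pos
  unfold solConst
  positivity

namespace IsFreeSolution

variable {n : ℤ} {z : ℂ} {C : ℝ} {f y : H0} {c₁ c₂ : ℂ}

theorem integrals_le (hz : z ∈ Metric.sphere (n : ℂ) (1 / 2)) (f : H0) :
    ‖∫ t in 0..π, Complex.exp (Complex.I * z * t) * (Complex.I • f.fst : L2I) t‖ +
      ‖∫ t in 0..π, Complex.exp (-(Complex.I * z) * t) * (-Complex.I • f.snd : L2I) t‖ ≤
    2 * (π * Real.exp π) * ‖f‖ := by
  have h1 := norm_integral_exp_mul_le (abs_re_le_of_norm_sub_le (norm_I_mul_sub_le hz))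
    (Complex.I • f.fst) pi_mem_Icc_pi
  have h2 := norm_integral_exp_mul_le (abs_re_le_of_norm_sub_le (norm_neg_I_mul_sub_le hz))
    (-Complex.I • f.snd) pi_mem_Icc_pi
  rw [norm_I_smul] at h1
  rw [norm_neg_I_smul] at h2
  have hp : 0 ≤ π * Real.exp π := by have := Real.pi_pos; positivity
  have h3 := mul_le_mul_of_nonneg_left (norm_fst_le f) hp
  have h4 := mul_le_mul_of_nonneg_left (norm_snd_le f) hp
  linarith

theorem norm_left_le (h : IsFreeSolution z C f y c₁ c₂) (hC : 0 ≤ C)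
    (hz : z ∈ Metric.sphere (n : ℂ) (1 / 2)) : ‖c₁‖ ≤ solConst C * ‖f‖ := by
  rw [solConst, mul_assoc]
  exact h.norm_left.trans (mul_le_mul_of_nonneg_left (integrals_le hz f) hC)

theorem norm_right_le (h : IsFreeSolution z C f y c₁ c₂) (hC : 0 ≤ C)
    (hz : z ∈ Metric.sphere (n : ℂ) (1 / 2)) : ‖c₂‖ ≤ solConst C * ‖f‖ := by
  rw [solConst, mul_assoc]
  exact h.norm_right.trans (mul_le_mul_of_nonneg_left (integrals_le hz f) hC)

/-- A supremum bound is needed rather than an `L²` bound: only then is the product with an `L²`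
potential controlled in `L²`. -/
theorem fst_bound (h : IsFreeSolution z C f y c₁ c₂) (hC : 0 ≤ C)
    (hz : z ∈ Metric.sphere (n : ℂ) (1 / 2)) :
    ∀ᵐ t ∂μI, ‖y.fst t‖ ≤ growthConst * (solConst C + 1) * ‖f‖ := by
  filter_upwards [h.fst_ae, ae_mem_Icc_μI] with t h1 h2
  rw [h1, mul_assoc]
  refine (norm_duhamel_le (abs_re_le_of_norm_sub_le (norm_neg_I_mul_sub_le hz)) _ h2).trans
    (mul_le_mul_of_nonneg_left ?_ growthConst_pos.le)
  rw [norm_I_smul]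
  linarith [h.norm_left_le hC hz, norm_fst_le f]

theorem snd_bound (h : IsFreeSolution z C f y c₁ c₂) (hC : 0 ≤ C)
    (hz : z ∈ Metric.sphere (n : ℂ) (1 / 2)) :
    ∀ᵐ t ∂μI, ‖y.snd t‖ ≤ growthConst * (solConst C + 1) * ‖f‖ := by
  filter_upwards [h.snd_ae, ae_mem_Icc_μI] with t h1 h2
  rw [h1, mul_assoc]
  refine (norm_duhamel_le (abs_re_le_of_norm_sub_le (norm_I_mul_sub_le hz)) _ h2).trans
    (mul_le_mul_of_nonneg_left ?_ growthConst_pos.le)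
  rw [norm_neg_I_smul]
  linarith [h.norm_right_le hC hz, norm_snd_le f]

end IsFreeSolution

/-! ### Second order bounds: the free resolvent applied twice with the potential in between. -/

/-- The same exponent `a` occurs in the kernel and in `y`, since the potential feeds each component
into the equation of the other. It is used with `a = iz`, `m = n` for `P` and with `a = -iz`, `m =
-n` for `Q`. -/
theorem norm_integral_forcing_le {a c α : ℂ} (hα : ‖α‖ = 1) {m : ℤ}
    (ha : ‖a - Complex.I * m‖ ≤ 1 / 2) (P k g y : L2I) (hg : ∀ᵐ t ∂μI, g t = P t * y t)
    (hy : ∀ᵐ t ∂μI, y t = duhamel a c k t) {x : ℝ} (hx : x ∈ Icc 0 π) :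
    ‖∫ t in 0..x, Complex.exp (a * t) * (α • g : L2I) t‖ ≤
      oscConst * (‖c‖ + ‖k‖) * (‖osc m P x‖ + oscNorm m P) := by
  have h1 : ∫ t in 0..x, Complex.exp (a * t) * (α • g : L2I) t =
      ∫ t in 0..x, α * (Complex.exp (a * t) * (P t * duhamel a c k t)) := by
    refine intervalIntegral.integral_congr_ae ?_
    filter_upwards [ae_of_ae_μI hg, ae_of_ae_μI hy, ae_of_ae_μI (Lp.coeFn_smul α g)]
      with t q1 q2 q3 ht
    rw [uIoc_of_le hx.1] at ht
    have ht' : t ∈ Icc 0 π := ⟨ht.1.le, ht.2.trans hx.2⟩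
    rw [q3 ht', Pi.smul_apply, q1 ht', q2 ht', smul_eq_mul]
    ring
  rw [h1, intervalIntegral.integral_const_mul, norm_mul, hα, one_mul]
  exact norm_integral_exp_mul_duhamel_le ha P k hx

theorem norm_duhamel_le_exp_mul {a c : ℂ} (ha : |a.re| ≤ 1) (k : ℝ → ℂ) {x : ℝ} (hx : x ∈ Icc 0 π) :
    ‖duhamel a c k x‖ ≤ Real.exp π * (‖c‖ + ‖∫ t in 0..x, Complex.exp (-a * t) * k t‖) := by
  rw [duhamel, norm_mul]
  exact mul_le_mul (norm_exp_mul_le ha hx) (norm_add_le _ _) (norm_nonneg _) (Real.exp_pos _).le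

/-- A constant for the second order term of the Neumann series. -/
noncomputable def secondConst (C : ℝ) : ℝ :=
  6 * (Real.exp π * (1 + C) * (oscConst * (solConst C + 1)))

theorem secondConst_nonneg {C : ℝ} (hC : 0 ≤ C) : 0 ≤ secondConst C := by
  have := solConst_nonneg hC
  have := oscConst_pos
  unfold secondConst
  positivity

/-- Cauchy–Schwarz with coefficients `1, 1, 2, 1, 1, 2`; the sum of their squares, `12`, is rounded
up to the square `36`. -/
theorem sq_le_of_le_sum {u K X X' X'' Y Y' Y'' : ℝ} (hu : 0 ≤ u)
    (h : u ≤ K * (X + X' + 2 * X'' + Y + Y' + 2 * Y'')) :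
    u ^ 2 ≤ (6 * K) ^ 2 * ((X ^ 2 + X' ^ 2 + X'' ^ 2) + (Y ^ 2 + Y' ^ 2 + Y'' ^ 2)) := by
  have h1 : (X + X' + 2 * X'' + Y + Y' + 2 * Y'') ^ 2 ≤
      36 * ((X ^ 2 + X' ^ 2 + X'' ^ 2) + (Y ^ 2 + Y' ^ 2 + Y'' ^ 2)) := by
    have := Finset.sum_mul_sq_le_sq_mul_sq (Finset.univ : Finset (Fin 6))
      ![1, 1, 2, 1, 1, 2] ![X, X', X'', Y, Y', Y'']
    simp [Fin.sum_univ_succ] at this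
    nlinarith [sq_nonneg X, sq_nonneg X', sq_nonneg X'', sq_nonneg Y, sq_nonneg Y',
      sq_nonneg Y'']
  calc u ^ 2 ≤ (K * (X + X' + 2 * X'' + Y + Y' + 2 * Y'')) ^ 2 := pow_le_pow_left₀ hu h 2
    _ = K ^ 2 * (X + X' + 2 * X'' + Y + Y' + 2 * Y'') ^ 2 := by ring
    _ ≤ K ^ 2 * (36 * ((X ^ 2 + X' ^ 2 + X'' ^ 2) + (Y ^ 2 + Y' ^ 2 + Y'' ^ 2))) := by gcongr
    _ = _ := by ring

namespace IsFreeSolution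

variable {n : ℤ} {z : ℂ} {C : ℝ} {f y g w : H0} {c₁ c₂ d₁ d₂ : ℂ} {P Q : L2I}

/-- Here `g = v y`, so `w` is the free resolvent applied to `v y`. Its forcing integrals, up to `t`
and, for the initial values, up to `π`, are all oscillatory. -/
theorem second_order_bound (h : IsFreeSolution z C f y c₁ c₂) (hC : 0 ≤ C)
    (hz : z ∈ Metric.sphere (n : ℂ) (1 / 2)) (hP : ∀ᵐ t ∂μI, g.fst t = P t * y.snd t)
    (hQ : ∀ᵐ t ∂μI, g.snd t = Q t * y.fst t) (hw : IsFreeSolution z C g w d₁ d₂) :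
    ∀ᵐ t ∂μI,
      ‖w.fst t‖ ^ 2 ≤ (secondConst C * ‖f‖) ^ 2 * (oscSq n P t + oscSq (-n) Q t) ∧
      ‖w.snd t‖ ^ 2 ≤ (secondConst C * ‖f‖) ^ 2 * (oscSq n P t + oscSq (-n) Q t) := by
  set K : ℝ := oscConst * (solConst C + 1) * ‖f‖ with hK
  have hK0 : 0 ≤ K := by
    have := solConst_nonneg hC
    have := oscConst_pos
    positivity
  have hA : ∀ x ∈ Icc 0 π,
      ‖∫ t in 0..x, Complex.exp (Complex.I * z * t) * (Complex.I • g.fst : L2I) t‖ ≤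
        K * (‖osc n P x‖ + oscNorm n P) := fun x hx => by
    refine (norm_integral_forcing_le Complex.norm_I (norm_I_mul_sub_le hz) P _ g.fst y.snd hP
      h.snd_ae hx).trans (mul_le_mul_of_nonneg_right ?_
        (add_nonneg (norm_nonneg _) (Real.sqrt_nonneg _)))
    rw [norm_neg_I_smul, hK, mul_assoc]
    refine mul_le_mul_of_nonneg_left ?_ oscConst_pos.le
    linarith [h.norm_right_le hC hz, norm_snd_le f]
  have hB : ∀ x ∈ Icc 0 π,
      ‖∫ t in 0..x, Complex.exp (-(Complex.I * z) * t) * (-Complex.I • g.snd : L2I) t‖ ≤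
        K * (‖osc (-n) Q x‖ + oscNorm (-n) Q) := fun x hx => by
    refine (norm_integral_forcing_le (by simp) (norm_neg_I_mul_sub_le hz) Q _ g.snd y.fst hQ
      h.fst_ae hx).trans (mul_le_mul_of_nonneg_right ?_
        (add_nonneg (norm_nonneg _) (Real.sqrt_nonneg _)))
    rw [norm_I_smul, hK, mul_assoc]
    refine mul_le_mul_of_nonneg_left ?_ oscConst_pos.le
    linarith [h.norm_left_le hC hz, norm_fst_le f]
  have hd : ‖∫ t in 0..π, Complex.exp (Complex.I * z * t) * (Complex.I • g.fst : L2I) t‖ +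
      ‖∫ t in 0..π, Complex.exp (-(Complex.I * z) * t) * (-Complex.I • g.snd : L2I) t‖ ≤
      K * (‖osc n P π‖ + oscNorm n P + (‖osc (-n) Q π‖ + oscNorm (-n) Q)) := by
    linarith [hA π pi_mem_Icc_pi, hB π pi_mem_Icc_pi]
  have hd₁ := hw.norm_left.trans (mul_le_mul_of_nonneg_left hd hC)
  have hd₂ := hw.norm_right.trans (mul_le_mul_of_nonneg_left hd hC)
  have hs : secondConst C * ‖f‖ = 6 * (Real.exp π * (1 + C) * K) := by
    rw [secondConst, hK]; ring
  have hL : 0 ≤ Real.exp π * (1 + C) * K := by positivity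
  have nX : 0 ≤ oscNorm n P := Real.sqrt_nonneg _
  have nY : 0 ≤ oscNorm (-n) Q := Real.sqrt_nonneg _
  -- `X`, `X'`, `X''` stand for `osc` at `t`, `osc` at `π` and `oscNorm`, and likewise `Y` for `Q`.
  -- The norm occurs both in the initial value `d` and in the forcing `T`, hence the coefficient
  -- `2`.
  have comb : ∀ {d T X X' X'' Y Y' Y'' : ℝ}, 0 ≤ X → 0 ≤ X' → 0 ≤ X'' → 0 ≤ Y → 0 ≤ Y' →
      0 ≤ Y'' → d ≤ C * (K * (X' + X'' + (Y' + Y''))) → T ≤ K * (X + X'' + (Y + Y'')) →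
      Real.exp π * (d + T) ≤
        Real.exp π * (1 + C) * K * (X + X' + 2 * X'' + Y + Y' + 2 * Y'') := by
    intro d T X X' X'' Y Y' Y'' hX hX' hX'' hY hY' hY'' h1 h2
    rw [mul_assoc, mul_assoc]
    refine mul_le_mul_of_nonneg_left ((add_le_add h1 h2).trans ?_) (Real.exp_pos _).le
    have q1 : 0 ≤ C * K * (X + X'' + Y + Y'') := by positivity
    have q2 : 0 ≤ K * (X' + X'' + Y' + Y'') := by positivity
    linarith
  filter_upwards [hw.fst_ae, hw.snd_ae, ae_mem_Icc_μI] with t e₁ e₂ ht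
  rw [hs]
  constructor
  · refine sq_le_of_le_sum (norm_nonneg _) ?_
    rw [e₁]
    refine (norm_duhamel_le_exp_mul (abs_re_le_of_norm_sub_le (norm_neg_I_mul_sub_le hz)) _ ht).trans ?_
    rw [neg_neg]
    refine comb (norm_nonneg _) (norm_nonneg _) nX (norm_nonneg _) (norm_nonneg _) nY hd₁
      ((hA t ht).trans (mul_le_mul_of_nonneg_left ?_ hK0))
    linarith [norm_nonneg (osc (-n) Q t)]
  · refine sq_le_of_le_sum (norm_nonneg _) ?_
    rw [e₂]
    refine (norm_duhamel_le_exp_mul (abs_re_le_of_norm_sub_le (norm_I_mul_sub_le hz)) _ ht).trans ?_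
    refine comb (norm_nonneg _) (norm_nonneg _) nX (norm_nonneg _) (norm_nonneg _) nY hd₂
      ((hB t ht).trans (mul_le_mul_of_nonneg_left ?_ hK0))
    linarith [norm_nonneg (osc n P t)]

end IsFreeSolution

/-! ### From pointwise bounds to norms. -/

theorem norm_le_of_ae_bound {f : L2I} {K : ℝ} (hK : 0 ≤ K) (h : ∀ᵐ t ∂μI, ‖f t‖ ≤ K) :
    ‖f‖ ≤ K := by
  have := norm_L2I_le_of_sq hK (integrable_const (1 : ℝ)) (f := f) (by
    filter_upwards [h] with t ht
    rw [mul_one]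
    exact pow_le_pow_left₀ (norm_nonneg _) ht 2)
  simpa using this

theorem norm_mul_le_of_ae_bound {f P y : L2I} {K : ℝ} (hK : 0 ≤ K)
    (hf : ∀ᵐ t ∂μI, f t = P t * y t) (h : ∀ᵐ t ∂μI, ‖y t‖ ≤ K) : ‖f‖ ≤ K * ‖P‖ := by
  have := norm_L2I_le_of_sq hK (integrable_norm_sq P) (f := f) (by
    filter_upwards [h, hf] with t h1 h2
    rw [h2, norm_mul, mul_pow, mul_comm]
    gcongr)
  rwa [← norm_sq_L2I, Real.sqrt_sq (norm_nonneg _)] at this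

/-- With `p = 1` this bounds the components of `R₀ V R₀ f`, with `p = ‖P‖²` or `‖Q‖²` those of `V R₀
V R₀ f`; the weight dominates all three, so one energy serves both operators. -/
theorem norm_le_sqrt_oscEnergy {f : L2I} {p : ℝ → ℝ} {u : ℝ → ℂ} {P Q : L2I} {n : ℤ} {K : ℝ}
    (hK : 0 ≤ K) (hpw : ∀ t, p t ≤ weight P Q t)
    (hf : ∀ᵐ t ∂μI, ‖f t‖ ^ 2 = p t * ‖u t‖ ^ 2)
    (hu : ∀ᵐ t ∂μI, ‖u t‖ ^ 2 ≤ K ^ 2 * (oscSq n P t + oscSq (-n) Q t)) :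
    ‖f‖ ≤ K * √(oscEnergy P Q n) := by
  refine norm_L2I_le_of_sq hK (integrable_weight_mul_oscSq P Q n) ?_
  filter_upwards [hf, hu] with t h1 h2
  have h0 := add_nonneg (oscSq_nonneg n P t) (oscSq_nonneg (-n) Q t)
  calc ‖f t‖ ^ 2 = p t * ‖u t‖ ^ 2 := h1
    _ ≤ weight P Q t * (K ^ 2 * (oscSq n P t + oscSq (-n) Q t)) :=
      mul_le_mul (hpw t) h2 (by positivity) (weight_nonneg P Q t)
    _ = _ := by ring

theorem one_le_weight (P Q : L2I) (t : ℝ) : 1 ≤ weight P Q t := by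
  unfold weight
  linarith [sq_nonneg ‖P t‖, sq_nonneg ‖Q t‖]

theorem norm_sq_left_le_weight (P Q : L2I) (t : ℝ) : ‖P t‖ ^ 2 ≤ weight P Q t := by
  unfold weight
  linarith [sq_nonneg ‖Q t‖]

theorem norm_sq_right_le_weight (P Q : L2I) (t : ℝ) : ‖Q t‖ ^ 2 ≤ weight P Q t := by
  unfold weight
  linarith [sq_nonneg ‖P t‖]

/-! ### Comparison of the perturbed and the free resolvent. -/

theorem sphere_subset_resolventSet_freeDirac (bc : BC) (n : ℤ) :
    Metric.sphere (n : ℂ) (1 / 2) ⊆ unbddResolventSet (freeDirac bc) := by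
  intro z hz
  obtain ⟨C, hC, hsol⟩ := exists_isFreeSolution bc
  refine mem_unbddResolventSet_of_bound (C := 2 * (growthConst * (solConst C + 1)))
    (exists_solution_freeDirac bc hz) fun y => ?_
  obtain ⟨c₁, c₂, h⟩ := hsol n z hz y _ rfl
  have hg := growthConst_pos
  have hs := solConst_nonneg hC
  rw [mul_assoc]
  exact norm_le_of_components (norm_le_of_ae_bound (by positivity) (h.fst_bound hC hz))
    (norm_le_of_ae_bound (by positivity) (h.snd_bound hC hz))

/-- Resolvent comparison on the circles around the integers. -/
theorem exists_resolvent_comparison (bc : BC) (P Q : L2I) :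
    ∃ K L : ℝ, 0 ≤ K ∧ 0 ≤ L ∧ ∀ n : ℤ, K * √(oscEnergy P Q n) ≤ 1 / 2 →
      ∀ z ∈ Metric.sphere (n : ℂ) (1 / 2), ∃ R : H0 →L[ℂ] H0,
        IsResolventAt (dirac bc P Q) z R ∧
        ‖R - unbddResolvent (freeDirac bc) z‖ ≤ L * √(oscEnergy P Q n) := by
  obtain ⟨C, hC, hsol⟩ := exists_isFreeSolution bc
  have hg := growthConst_pos
  have hs := solConst_nonneg hC
  have h2 := secondConst_nonneg hC
  set M := growthConst * (solConst C + 1) with hM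
  have hM0 : 0 ≤ M := by positivity
  refine ⟨2 * secondConst C, 2 * secondConst C * (2 * (1 + 2 * (M * (‖P‖ + ‖Q‖)))),
    by positivity, by positivity, fun n hn z hz => ?_⟩
  have h0 := isResolventAt_unbddResolvent (sphere_subset_resolventSet_freeDirac bc n hz)
  -- `C` is the first order bound for `V R₀`, `δ` the second order bound for `R₀ V R₀` and `(V
  -- R₀)²`. The factors `2` in front come from passing from components to `H0`.
  have key := IsResolventAt.exists_perturb (dirac_apply_eq bc P Q) h0
    (C := 2 * (M * (‖P‖ + ‖Q‖))) (δ := 2 * secondConst C * √(oscEnergy P Q n))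
    (by positivity) (fun y => ?_) (fun y w hw => ?_) (by positivity) hn
  · obtain ⟨R, hR, hle⟩ := key
    exact ⟨R, hR, hle.trans (le_of_eq (by ring))⟩
  · obtain ⟨c₁, c₂, h⟩ := hsol n z hz y _ rfl
    set f := z • (y : H0) - (freeDirac bc).toFun y
    have b₁ := norm_mul_le_of_ae_bound (by positivity) (potential_fst_ae bc P Q y)
      (h.snd_bound hC hz)
    have b₂ := norm_mul_le_of_ae_bound (by positivity) (potential_snd_ae bc P Q y)
      (h.fst_bound hC hz)
    have := norm_le_of_components (f := potential bc P Q y) (C := M * ‖f‖ * (‖P‖ + ‖Q‖))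
      (b₁.trans (by gcongr; linarith [norm_nonneg Q]))
      (b₂.trans (by gcongr; linarith [norm_nonneg P]))
    calc _ ≤ _ := this
      _ = 2 * (M * (‖P‖ + ‖Q‖)) * ‖f‖ := by ring
  · obtain ⟨c₁, c₂, h⟩ := hsol n z hz y _ rfl
    obtain ⟨d₁, d₂, h'⟩ := hsol n z hz w _ hw
    set f := z • (y : H0) - (freeDirac bc).toFun y
    have hb := h.second_order_bound hC hz (potential_fst_ae bc P Q y) (potential_snd_ae bc P Q y) h'
    have hb₁ := hb.mono fun _ h => h.1
    have hb₂ := hb.mono fun _ h => h.2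
    have hK : 0 ≤ secondConst C * ‖f‖ := by positivity
    have w₁ := norm_le_sqrt_oscEnergy (f := (w : H0).fst) hK
      (one_le_weight P Q) (Filter.Eventually.of_forall fun t => (one_mul _).symm) hb₁
    have w₂ := norm_le_sqrt_oscEnergy (f := (w : H0).snd) hK
      (one_le_weight P Q) (Filter.Eventually.of_forall fun t => (one_mul _).symm) hb₂
    have v₁ := norm_le_sqrt_oscEnergy (f := (potential bc P Q w).fst) hK
      (norm_sq_left_le_weight P Q)
      ((potential_fst_ae bc P Q w).mono fun t ht => by rw [ht, norm_mul, mul_pow]) hb₂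
    have v₂ := norm_le_sqrt_oscEnergy (f := (potential bc P Q w).snd) hK
      (norm_sq_right_le_weight P Q)
      ((potential_snd_ae bc P Q w).mono fun t ht => by rw [ht, norm_mul, mul_pow]) hb₁
    have e : 2 * (secondConst C * ‖f‖ * √(oscEnergy P Q n)) =
      2 * secondConst C * √(oscEnergy P Q n) * ‖f‖ := by ring
    exact ⟨(norm_le_of_components w₁ w₂).trans e.le, (norm_le_of_components v₁ v₂).trans e.le⟩

/-- Summability forces `η → 0` along the cofinite filter, so the inequality fails for finitely many
`n` only. -/
theorem exists_nat_forall_le_of_summable {η : ℤ → ℝ} (h : Summable η) {K : ℝ} :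
    ∃ N : ℕ, ∀ n : ℤ, (N : ℤ) < |n| → K * √(η n) ≤ 1 / 2 := by
  have h1 := ((Real.continuous_sqrt.tendsto 0).comp h.tendsto_cofinite_zero).const_mul K
  rw [Real.sqrt_zero, mul_zero] at h1
  have h2 := h1.eventually_le_const (u := 1 / 2) (by norm_num)
  rw [Filter.eventually_cofinite] at h2
  obtain ⟨N, hN⟩ := (h2.image Int.natAbs).bddAbove
  refine ⟨N, fun n hn => ?_⟩
  by_contra hc
  have h3 : n.natAbs ≤ N := hN ⟨n, hc, rfl⟩
  rw [Int.abs_eq_natAbs] at hn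
  omega

end DiracOp

theorem theorem1 (bc : DiracOp.BC) (P Q : DiracOp.L2I) :
    ∃ N : ℕ,
      (∀ n : ℤ, (N : ℤ) < |n| →
        DiracOp.RieszWellDefined (DiracOp.dirac bc P Q) (n : ℂ) (1 / 2) ∧
        DiracOp.RieszWellDefined (DiracOp.freeDirac bc) (n : ℂ) (1 / 2)) ∧
      Summable (fun n : {n : ℤ // (N : ℤ) < |n|} =>
        ‖DiracOp.rieszProj (DiracOp.dirac bc P Q) ((n : ℤ) : ℂ) (1 / 2) -
          DiracOp.rieszProj (DiracOp.freeDirac bc) ((n : ℤ) : ℂ) (1 / 2)‖ ^ 2) := by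
  obtain ⟨K, L, hK, hL, H⟩ := DiracOp.exists_resolvent_comparison bc P Q
  have hsum := DiracOp.summable_oscEnergy P Q
  obtain ⟨N, hN⟩ := DiracOp.exists_nat_forall_le_of_summable hsum (K := K)
  have hfree : ∀ n : ℤ, DiracOp.RieszWellDefined (DiracOp.freeDirac bc) (n : ℂ) (1 / 2) :=
    fun n => DiracOp.rieszWellDefined_of_subset (by norm_num)
      (DiracOp.sphere_subset_resolventSet_freeDirac bc n)
  have hdir : ∀ n : ℤ, (N : ℤ) < |n| →
      DiracOp.RieszWellDefined (DiracOp.dirac bc P Q) (n : ℂ) (1 / 2) := fun n hn =>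
    DiracOp.rieszWellDefined_of_subset (by norm_num) fun z hz => by
      obtain ⟨R, hR, -⟩ := H n (hN n hn) z hz
      exact ⟨R, hR⟩
  refine ⟨N, fun n hn => ⟨hdir n hn, hfree n⟩, ?_⟩
  refine Summable.of_nonneg_of_le (fun _ => by positivity) (fun n => ?_)
    ((hsum.mul_left ((1 / 2 * L) ^ 2)).comp_injective Subtype.val_injective)
  -- The projections differ by at most `(1/2) L √(oscEnergy P Q n)`, whose square is a constant
  -- times the summable energy. Uniqueness of bounded inverses identifies `R` with `unbddResolvent`.
  have h1 := DiracOp.norm_rieszProj_sub_le (by norm_num) (hdir n n.2) (hfree n)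
    (C := L * √(DiracOp.oscEnergy P Q n)) fun z hz => by
      obtain ⟨R, hR, hle⟩ := H n (hN n n.2) z hz
      rwa [(DiracOp.isResolventAt_unbddResolvent ⟨R, hR⟩).unique hR]
  refine (pow_le_pow_left₀ (norm_nonneg _) h1 2).trans (le_of_eq ?_)
  rw [← mul_assoc, mul_pow, Real.sq_sqrt (DiracOp.oscEnergy_nonneg P Q n)]
  rfl
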